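/- Let $n\ge 4$ and let $(M,g)$ be a smooth $n$-dimensional Lorentzian manifold of signature $(-,+,\dots,+)$, with Levi-Civita connection $\nabla$, $\Box=\nabla^c\nabla_c$, Riemann tensor normalized by $v_{a;bc}-v_{a;cb}=R^d{}_{abc}v_d$, Ricci tensor $R_{ab}=R^c{}_{acb}$, scalar curvature $R$ and Weyl tensor $C_{abcd}$. Let $\alpha,\beta,\gamma,\kappa,\Lambda_0$ be real constants with $\kappa\neq0$ and $\beta\neq 0$, and suppose that $g$ solves the source-free field equations of quadratic gravity $$\begin{aligned} &\tfrac1\kappa\left(R_{ab}-\tfrac12Rg_{ab}+\Lambda_0g_{ab}\right)+2\alpha R\left(R_{ab}-\tfrac14Rg_{ab}\right)+(2\alpha+\beta)\left(g_{ab}\Box-\nabla_a\nabla_b\right)R\\ &+2\gamma\Big(RR_{ab}-2R_{acbd}R^{cd}+R_{acde}R_b{}^{cde}-2R_{ac}R_b{}^c-\tfrac14g_{ab}\left(R_{cdef}R^{cdef}-4R_{cd}R^{cd}+R^2\right)\Big)\\ &+\beta\Box\left(R_{ab}-\tfrac12Rg_{ab}\right)+2\beta\left(R_{acbd}-\tfrac14g_{ab}R_{cd}\right)R^{cd}=0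 . \end{aligned}$$ Suppose further that there are a constant $\Lambda\in\mathbb R$, a smooth nowhere vanishing function $\Phi$ and a smooth nowhere vanishing null vector field $\ell$ with $$R_{ab}=\frac{2\Lambda}{n-2}\,g_{ab}+\Phi\,\ell_a\ell_b .$$ A null frame at a point consists of $\ell$, a null vector $\mathbf n$ and vectors $m_{(i)}$ ($2\le i\le n-1$) with $\mathbf n\cdot\ell=1$, $m_{(i)}\cdot m_{(j)}=\delta_{ij}$, and $m_{(i)}$ orthogonal to $\ell$ and $\mathbf n$; a frame index $0$, $1$, $i$ denotes contraction with $\ell$, $\mathbf n$, $m_{(i)}$, respectively. Suppose that at every point either * $C_{abcd}=0$ (type O, conformally flat), or * in some null frame containing $\ell$, $C_{0i0j}=C_{0ijk}=C_{ijkl}=C_{01ij}=0$ for all $i,j,k,l$, and moreover either * (type III(B)) some $C_{1ijk}\ne0$ and $\tfrac12C_{1ijk}C_{1ijk}-C_{101i}C_{101i}=0$ (summation over repeated indices), or * (type N) all $C_{1ijk}=0$ and some $C_{1i1j}\neq0$. Thus the null radiation is aligned: where the Weyl tensor is of type III(B) or N, $\ell$ is a multiple Weyl aligned null direction. Then $(M,g)$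 belongs to the Kundt class, i.e. it admits a geodetic null congruence with vanishing expansion, shear and twist. More precisely, $\ell$ is such a congruence: it is geodetic ($\ell_{a;b}\ell^b\propto\ell_a$), and in every null frame containing $\ell$ the optical matrix $L_{ij}=\ell_{a;b}m^a_{(i)}m^b_{(j)}$ has vanishing expansion $\theta=\frac1{n-2}L_{ii}$, shear $\sigma^2=\sigma_{ij}\sigma_{ij}$, where $\sigma_{ij}=L_{(ij)}-\theta\delta_{ij}$, and twist $\omega^2=A_{ij}A_{ij}$, where $A_{ij}=L_{[ij]}$. If $\ell$ is affinely parametrized ($\ell_{a;b}\ell^b=0$), then $\mathrm D\Phi:=\ell^a\nabla_a\Phi=0$. Affine parametrization is no loss of generality: there is a smooth function $c>0$ on $M$ such that $\hat\ell=c\,\ell$ is affinely parametrized, and then $\hat\Phi=c^{-2}\Phi$, for which $\hat\Phi\,\hat\ell_a\hat\ell_b=\Phi\,\ell_a\ell_b$, satisfies $\hat\ell^a\nabla_a\hat\Phi=0$. -/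

import Mathlib

open scoped Manifold ContDiff

noncomputable section

namespace QuadraticGravity

/-! ### Tensor calculus in a coordinate chart

Coordinates `y` range over `Coord n`, a metric is given by its matrix of components `G y`, and all
index sums are written out.  The signature is `(-,+,...,+)`. -/

/-- The coordinate space. -/
abbrev Coord (n : ℕ) : Type := EuclideanSpace ℝ (Fin n)

/-- A field of covectors (or vectors), in components. -/
abbrev Field1 (n : ℕ) : Type := Coord n → Fin n → ℝ

/-- A field of covariant 2-tensors, in components. -/
abbrev Field2 (n : ℕ) : Type := Coord n → Fin n → Fin n → ℝ

/-- A field of covariant 3-tensors, in components. -/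
abbrev Field3 (n : ℕ) : Type := Coord n → Fin n → Fin n → Fin n → ℝ

/-- The components of the metric. -/
abbrev MetricField (n : ℕ) : Type := Coord n → Matrix (Fin n) (Fin n) ℝ

variable {n : ℕ}

/-- The partial derivative `∂_a f` at `y`. -/
def pd (f : Coord n → ℝ) (a : Fin n) (y : Coord n) : ℝ :=
  fderiv ℝ f y (EuclideanSpace.single a 1)

/-- The inverse metric `g^{ab}`. -/
def ginv (G : MetricField n) (y : Coord n) (a b : Fin n) : ℝ := (G y)⁻¹ a b

/-- The Christoffel symbols `Γ^a_{bc}` of the Levi-Civita connection. -/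
def christoffel (G : MetricField n) (y : Coord n) (a b c : Fin n) : ℝ :=
  (1 / 2) * ∑ d, ginv G y a d *
    (pd (fun z => G z d c) b y + pd (fun z => G z d b) c y - pd (fun z => G z b c) d y)

/-- The Riemann tensor `R^a_{bcd}`. -/
def riemannUp (G : MetricField n) (y : Coord n) (a b c d : Fin n) : ℝ :=
  pd (fun z => christoffel G z a b d) c y - pd (fun z => christoffel G z a b c) d y
    + ∑ e, (christoffel G y a c e * christoffel G y e b d
      - christoffel G y a d e * christoffel G y e b c)

/-- The Riemann tensor `R_{abcd}`. -/
def riemann (G : MetricField n) (y : Coord n) (a b c d : Fin n) : ℝ :=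
  ∑ e, G y a e * riemannUp G y e b c d

/-- The Ricci tensor `R_{ab} = R^c_{acb}`. -/
def ricci (G : MetricField n) (y : Coord n) (a b : Fin n) : ℝ :=
  ∑ c, riemannUp G y c a c b

/-- The scalar curvature. -/
def scalarCurv (G : MetricField n) (y : Coord n) : ℝ :=
  ∑ a, ∑ b, ginv G y a b * ricci G y a b

/-- The Weyl tensor `C_{abcd}`. -/
def weyl (G : MetricField n) (y : Coord n) (a b c d : Fin n) : ℝ :=
  riemann G y a b c d
    - (1 / ((n : ℝ) - 2)) *
      (G y a c * ricci G y d b - G y a d * ricci G y c b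
        - G y b c * ricci G y d a + G y b d * ricci G y c a)
    + (1 / (((n : ℝ) - 1) * ((n : ℝ) - 2))) * scalarCurv G y *
      (G y a c * G y d b - G y a d * G y c b)

/-- `nabla1 G v y c a = ∇_c v_a`. -/
def nabla1 (G : MetricField n) (v : Field1 n) : Field2 n := fun y c a =>
  pd (fun z => v z a) c y - ∑ d, christoffel G y d c a * v y d

/-- `nabla2 G T y c a b = ∇_c T_{ab}`. -/
def nabla2 (G : MetricField n) (T : Field2 n) : Field3 n := fun y c a b =>
  pd (fun z => T z a b) c y
    - ∑ d, (christoffel G y d c a * T y d b + christoffel G y d c b * T y a d)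

/-- `nabla3 G S y d c a b = ∇_d S_{cab}`. -/
def nabla3 (G : MetricField n) (S : Field3 n) (y : Coord n) (d c a b : Fin n) : ℝ :=
  pd (fun z => S z c a b) d y
    - ∑ e, (christoffel G y e d c * S y e a b + christoffel G y e d a * S y c e b
      + christoffel G y e d b * S y c a e)

/-- The second covariant derivative `∇_a ∇_b f` of a scalar. -/
def hess (G : MetricField n) (f : Coord n → ℝ) : Field2 n :=
  nabla1 G (fun y a => pd f a y)

/-- The d'Alembert operator on scalars. -/
def box0 (G : MetricField n) (f : Coord n → ℝ) (y : Coord n) : ℝ :=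
  ∑ c, ∑ d, ginv G y c d * hess G f y c d

/-- The d'Alembert operator `g^{cd} ∇_c ∇_d` on covariant 2-tensors. -/
def box2 (G : MetricField n) (T : Field2 n) : Field2 n := fun y a b =>
  ∑ c, ∑ d, ginv G y c d * nabla3 G (nabla2 G T) y c d a b

/-- `R^{ab}`. -/
def ricciUp (G : MetricField n) (y : Coord n) (a b : Fin n) : ℝ :=
  ∑ c, ∑ d, ginv G y a c * ginv G y b d * ricci G y c d

/-- `R_{cd} R^{cd}`. -/
def ricciSq (G : MetricField n) (y : Coord n) : ℝ :=
  ∑ c, ∑ d, ricci G y c d * ricciUp G y c d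

/-- `R_{ac} R_b^c`. -/
def ricciRicci (G : MetricField n) (y : Coord n) (a b : Fin n) : ℝ :=
  ∑ c, ∑ d, ginv G y c d * ricci G y a c * ricci G y b d

/-- `R_{acbd} R^{cd}`. -/
def riemannRicci (G : MetricField n) (y : Coord n) (a b : Fin n) : ℝ :=
  ∑ c, ∑ d, riemann G y a c b d * ricciUp G y c d

/-- `R_{acde} R_b^{cde}`. -/
def riemannRiemann (G : MetricField n) (y : Coord n) (a b : Fin n) : ℝ :=
  ∑ c, ∑ d, ∑ e, ∑ c', ∑ d', ∑ e', ginv G y c c' * ginv G y d d' * ginv G y e e' *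
    riemann G y a c d e * riemann G y b c' d' e'

/-- `R_{cdef} R^{cdef}`. -/
def riemannSq (G : MetricField n) (y : Coord n) : ℝ :=
  ∑ a, ∑ b, ginv G y a b * riemannRiemann G y a b

/-- The left-hand side `E_{ab}` of the source-free field equations of quadratic gravity, i.e. of the
theory with Lagrangian
`κ⁻¹ (R - 2 Λ₀) + α R² + β R_{ab} R^{ab} + γ (R_{abcd} R^{abcd} - 4 R_{ab} R^{ab} + R²)`. -/
def fieldEqLhs (G : MetricField n) (α β γ κ Λ₀ : ℝ) (y : Coord n) (a b : Fin n) : ℝ :=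
  (1 / κ) * (ricci G y a b - (1 / 2) * scalarCurv G y * G y a b + Λ₀ * G y a b)
    + 2 * α * scalarCurv G y * (ricci G y a b - (1 / 4) * scalarCurv G y * G y a b)
    + (2 * α + β) * (G y a b * box0 G (scalarCurv G) y - hess G (scalarCurv G) y a b)
    + 2 * γ * (scalarCurv G y * ricci G y a b - 2 * riemannRicci G y a b
        + riemannRiemann G y a b - 2 * ricciRicci G y a b
        - (1 / 4) * G y a b *
          (riemannSq G y - 4 * ricciSq G y + scalarCurv G y ^ 2))
    + β * box2 G (fun z c d => ricci G z c d - (1 / 2) * scalarCurv G z * G z c d) y a b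
    + 2 * β * (riemannRicci G y a b - (1 / 4) * G y a b * ricciSq G y)

/-! ### Null frames, Weyl types and optical scalars at a point of a chart -/

/-- The scalar product of two vectors, given by components. -/
def dot (g : Matrix (Fin n) (Fin n) ℝ) (u v : Fin n → ℝ) : ℝ := ∑ a, ∑ b, g a b * u a * v b

/-- `l, k, m 0, ..., m (n - 3)` is a real null frame: `l` and `k` are null, `k · l = 1`, and the
`m i` are orthonormal and orthogonal to `l` and `k`. (Here `k` is the second null vector, commonly
written `n`.) -/
structure IsNullFrame (g : Matrix (Fin n) (Fin n) ℝ) (l k : Fin n → ℝ)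
    (m : Fin (n - 2) → Fin n → ℝ) : Prop where
  l_null : dot g l l = 0
  k_null : dot g k k = 0
  k_l : dot g k l = 1
  l_m : ∀ i, dot g l (m i) = 0
  k_m : ∀ i, dot g k (m i) = 0
  m_m : ∀ i j, dot g (m i) (m j) = if i = j then 1 else 0

/-- The frame component `T_{abcd} u^a v^b w^c z^d`. -/
def comp4 (T : Fin n → Fin n → Fin n → Fin n → ℝ) (u v w z : Fin n → ℝ) : ℝ :=
  ∑ a, ∑ b, ∑ c, ∑ d, T a b c d * u a * v b * w c * z d

/-- The Weyl tensor has no components of boost weight `2`, `1`, `0` in the given frame: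
`C_{0i0j} = C_{0ijk} = C_{ijkl} = C_{01ij} = 0`, where the index `0` stands for a contraction
with `l` and the index `1` for a contraction with `k`. -/
structure OnlyNegativeBoostWeight (C : Fin n → Fin n → Fin n → Fin n → ℝ) (l k : Fin n → ℝ)
    (m : Fin (n - 2) → Fin n → ℝ) : Prop where
  c0i0j : ∀ i j, comp4 C l (m i) l (m j) = 0
  c0ijk : ∀ i j p, comp4 C l (m i) (m j) (m p) = 0
  cijkl : ∀ i j p q, comp4 C (m i) (m j) (m p) (m q) = 0
  c01ij : ∀ i j, comp4 C l k (m i) (m j) = 0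

/-- The quantity `½ Ψ'_{ijk} Ψ'_{ijk} - Ψ'_i Ψ'_i` with `Ψ'_{ijk} = C_{1ijk}`,
`Ψ'_i = C_{101i}`. -/
def tildePsi (C : Fin n → Fin n → Fin n → Fin n → ℝ) (l k : Fin n → ℝ)
    (m : Fin (n - 2) → Fin n → ℝ) : ℝ :=
  (1 / 2) * ∑ i, ∑ j, ∑ p, comp4 C k (m i) (m j) (m p) ^ 2 - ∑ i, comp4 C k l k (m i) ^ 2

/-- The Weyl tensor of `G` at `y` is of type III(B) with multiple Weyl aligned null direction
`l`. -/
def IsWeylTypeIIIB (G : MetricField n) (l : Fin n → ℝ) (y : Coord n) : Prop :=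
  ∃ (k : Fin n → ℝ) (m : Fin (n - 2) → Fin n → ℝ), IsNullFrame (G y) l k m ∧
    OnlyNegativeBoostWeight (weyl G y) l k m ∧
    (∃ i j p, comp4 (weyl G y) k (m i) (m j) (m p) ≠ 0) ∧
    tildePsi (weyl G y) l k m = 0

/-- The Weyl tensor of `G` at `y` is of type N with multiple Weyl aligned null direction `l`. -/
def IsWeylTypeN (G : MetricField n) (l : Fin n → ℝ) (y : Coord n) : Prop :=
  ∃ (k : Fin n → ℝ) (m : Fin (n - 2) → Fin n → ℝ), IsNullFrame (G y) l k m ∧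
    OnlyNegativeBoostWeight (weyl G y) l k m ∧
    (∀ i j p, comp4 (weyl G y) k (m i) (m j) (m p) = 0) ∧
    (∃ i j, comp4 (weyl G y) k (m i) k (m j) ≠ 0)

/-- The Weyl tensor of `G` vanishes at `y` (type O, conformally flat). -/
def IsWeylTypeO (G : MetricField n) (y : Coord n) : Prop := ∀ a b c d, weyl G y a b c d = 0

/-- Lowering the index of a vector field. -/
def lower (G : MetricField n) (l : Field1 n) : Field1 n := fun y a => ∑ b, G y a b * l y b

/-- The vector field `l` (contravariant components) satisfies `l_{a;b} l^b ∝ l_a` at `y`. -/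
def IsGeodeticAt (G : MetricField n) (l : Field1 n) (y : Coord n) : Prop :=
  ∃ c : ℝ, ∀ a, ∑ b, nabla1 G (lower G l) y b a * l y b = c * lower G l y a

/-- The vector field `l` satisfies `l_{a;b} l^b = 0` at `y`. -/
def IsAffineGeodeticAt (G : MetricField n) (l : Field1 n) (y : Coord n) : Prop :=
  ∀ a, ∑ b, nabla1 G (lower G l) y b a * l y b = 0

/-- The optical matrix `L_{ij} = l_{a;b} m_i^a m_j^b`. -/
def opticalMatrix (G : MetricField n) (l : Field1 n) (y : Coord n)
    (m : Fin (n - 2) → Fin n → ℝ) (i j : Fin (n - 2)) : ℝ :=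
  ∑ a, ∑ b, nabla1 G (lower G l) y b a * m i a * m j b

/-- The expansion `θ = L_{ii} / (n - 2)`. -/
def expansion (L : Fin (n - 2) → Fin (n - 2) → ℝ) : ℝ := (1 / ((n : ℝ) - 2)) * ∑ i, L i i

/-- The squared shear `σ² = σ_{ij} σ_{ij}`, where `σ_{ij} = L_{(ij)} - θ δ_{ij}`. -/
def shearSq (L : Fin (n - 2) → Fin (n - 2) → ℝ) : ℝ :=
  ∑ i, ∑ j, ((1 / 2) * (L i j + L j i) - expansion L * (if i = j then 1 else 0)) ^ 2

/-- The squared twist `ω² = A_{ij} A_{ij}`, where `A_{ij} = L_{[ij]}`. -/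
def twistSq (L : Fin (n - 2) → Fin (n - 2) → ℝ) : ℝ :=
  ∑ i, ∑ j, ((1 / 2) * (L i j - L j i)) ^ 2

/-! ### Spacetimes -/

variable {M : Type*} [TopologicalSpace M] [ChartedSpace (EuclideanSpace ℝ (Fin n)) M]
  [IsManifold (𝓡 n) ∞ M]

variable (n M) in
/-- A smooth Lorentzian metric on the smooth `n`-manifold `M`. -/
structure LorentzMetric where
  inner (p : M) : TangentSpace (𝓡 n) p →L[ℝ] TangentSpace (𝓡 n) p →L[ℝ] ℝ
  symm (p : M) (u v : TangentSpace (𝓡 n) p) : inner p u v = inner p v u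
  /-- Every tangent space has a basis in which the metric is `diag (-1, 1, ..., 1)`. -/
  lorentzian (p : M) : ∃ b : Module.Basis (Fin n) ℝ (TangentSpace (𝓡 n) p),
    ∀ i j, inner p (b i) (b j) = if i = j then (if i.val = 0 then -1 else 1) else 0
  contMDiff : ContMDiff (𝓡 n)
    ((𝓡 n).prod 𝓘(ℝ, EuclideanSpace ℝ (Fin n) →L[ℝ] EuclideanSpace ℝ (Fin n) →L[ℝ] ℝ)) ∞
    (fun p => Bundle.TotalSpace.mk' (EuclideanSpace ℝ (Fin n) →L[ℝ] EuclideanSpace ℝ (Fin n) →L[ℝ] ℝ)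
      (E := fun p : M => TangentSpace (𝓡 n) p →L[ℝ] TangentSpace (𝓡 n) p →L[ℝ] ℝ) p (inner p))

/-- The charts of a manifold. -/
abbrev Chart (n : ℕ) (M : Type*) [TopologicalSpace M] : Type _ :=
  OpenPartialHomeomorph M (EuclideanSpace ℝ (Fin n))

/-- The components of the metric in a chart, `g_{ab} = g(∂_a, ∂_b)`. -/
def LorentzMetric.inChart (g : LorentzMetric n M) (e : Chart n M) : MetricField n := fun y =>
  Matrix.of fun a b => g.inner (e.symm y)
    (mfderiv (𝓡 n) (𝓡 n) e.symm y (EuclideanSpace.single a (1 : ℝ) : EuclideanSpace ℝ (Fin n)))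
    (mfderiv (𝓡 n) (𝓡 n) e.symm y (EuclideanSpace.single b (1 : ℝ) : EuclideanSpace ℝ (Fin n)))

/-- The contravariant components of a vector field in a chart. -/
def vecInChart (l : ∀ p : M, TangentSpace (𝓡 n) p) (e : Chart n M) : Field1 n := fun y a =>
  (show EuclideanSpace ℝ (Fin n) from mfderiv (𝓡 n) (𝓡 n) e (e.symm y) (l (e.symm y))) a

variable (n M) in
/-- `P e y` holds for every smooth coordinate chart `e` of `M` and all `y` in its range. -/
def InAllCharts (P : Chart n M → Coord n → Prop) : Prop :=
  ∀ e ∈ IsManifold.maximalAtlas (𝓡 n) ∞ M, ∀ y ∈ e.target, P e y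

/-- `l` is a smooth, nowhere vanishing null vector field. -/
structure IsNullVectorField (g : LorentzMetric n M) (l : ∀ p : M, TangentSpace (𝓡 n) p) : Prop where
  smooth : ContMDiff (𝓡 n) (𝓡 n).tangent ∞ (fun p => (⟨p, l p⟩ : TangentBundle (𝓡 n) M))
  ne_zero : ∀ p, l p ≠ 0
  null : ∀ p, g.inner p (l p) (l p) = 0

/-- The metric solves the source-free field equations of quadratic gravity. -/
def SolvesQuadraticGravity (g : LorentzMetric n M) (α β γ κ Λ₀ : ℝ) : Prop :=
  InAllCharts n M fun e y => ∀ a b, fieldEqLhs (g.inChart e) α β γ κ Λ₀ y a b = 0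

/-- `R_{ab} = 2 Λ / (n - 2) g_{ab} + Φ l_a l_b`. -/
def HasNullRadiationRicci (g : LorentzMetric n M) (l : ∀ p : M, TangentSpace (𝓡 n) p) (Λ : ℝ)
    (Φ : M → ℝ) : Prop :=
  InAllCharts n M fun e y => ∀ a b, ricci (g.inChart e) y a b =
    2 * Λ / ((n : ℝ) - 2) * g.inChart e y a b
      + Φ (e.symm y) * lower (g.inChart e) (vecInChart l e) y a
        * lower (g.inChart e) (vecInChart l e) y b

/-- At every point the Weyl tensor is of type III(B) or N with multiple Weyl aligned null direction
`l`, or vanishes. -/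
def IsWeylTypeIIIBOrNOrO (g : LorentzMetric n M) (l : ∀ p : M, TangentSpace (𝓡 n) p) : Prop :=
  InAllCharts n M fun e y => IsWeylTypeIIIB (g.inChart e) (vecInChart l e y) y ∨
    IsWeylTypeN (g.inChart e) (vecInChart l e y) y ∨ IsWeylTypeO (g.inChart e) y

/-- The integral curves of `l` are (not necessarily affinely parametrized) geodesics. -/
def IsGeodetic (g : LorentzMetric n M) (l : ∀ p : M, TangentSpace (𝓡 n) p) : Prop :=
  InAllCharts n M fun e y => IsGeodeticAt (g.inChart e) (vecInChart l e) y

/-- The integral curves of `l` are affinely parametrized geodesics. -/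
def IsAffineGeodetic (g : LorentzMetric n M) (l : ∀ p : M, TangentSpace (𝓡 n) p) : Prop :=
  InAllCharts n M fun e y => IsAffineGeodeticAt (g.inChart e) (vecInChart l e) y

/-- In every null frame containing `l`, the optical matrix of `l` satisfies `P`. -/
def OpticalMatrixSatisfies (g : LorentzMetric n M) (l : ∀ p : M, TangentSpace (𝓡 n) p)
    (P : (Fin (n - 2) → Fin (n - 2) → ℝ) → Prop) : Prop :=
  InAllCharts n M fun e y => ∀ (k : Fin n → ℝ) (m : Fin (n - 2) → Fin n → ℝ),
    IsNullFrame (g.inChart e y) (vecInChart l e y) k m →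
      P (opticalMatrix (g.inChart e) (vecInChart l e) y m)

/-- Vanishing expansion. -/
def NonExpanding (g : LorentzMetric n M) (l : ∀ p : M, TangentSpace (𝓡 n) p) : Prop :=
  OpticalMatrixSatisfies g l fun L => expansion L = 0

/-- Vanishing shear. -/
def NonShearing (g : LorentzMetric n M) (l : ∀ p : M, TangentSpace (𝓡 n) p) : Prop :=
  OpticalMatrixSatisfies g l fun L => shearSq L = 0

/-- Vanishing twist. -/
def NonTwisting (g : LorentzMetric n M) (l : ∀ p : M, TangentSpace (𝓡 n) p) : Prop :=
  OpticalMatrixSatisfies g l fun L => twistSq L = 0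

/-- The Kundt class: spacetimes admitting a geodetic null congruence without expansion, shear and
twist. -/
def IsKundt (g : LorentzMetric n M) : Prop :=
  ∃ l : ∀ p : M, TangentSpace (𝓡 n) p, IsNullVectorField g l ∧ IsGeodetic g l ∧
    NonExpanding g l ∧ NonShearing g l ∧ NonTwisting g l

/-- The derivative of the function `f` along the vector field `l` at `p`. -/
def derivAlong (l : ∀ p : M, TangentSpace (𝓡 n) p) (f : M → ℝ) (p : M) : ℝ :=
  mfderiv (𝓡 n) 𝓘(ℝ, ℝ) f p (l p)

end QuadraticGravity

end

/-!
# Kundt property of aligned null radiation in quadratic gravity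

Put `w = √|Φ| l` (index lowered), so that `Ric = r g + ε w ⊗ w` with the constant
`r = 2 Λ / (n - 2)` and a locally constant sign `ε`. Two identities for `∇w` are combined.

*Bianchi identity.* The scalar curvature is the constant `n r`, hence the contracted Bianchi
identity gives `∇^a (w_a w_b) = 0`, that is, `w^a ∇_a w_b = -(∇^a w_a) w_b`
(`IsMetricOn.div_radiation`). So `w` is geodetic.

*Field equations.* Only their components of boost weight `0` with respect to a null frame `l, k, m`
are needed. If the Weyl tensor has only components of negative boost weight, the components of
nonnegative boost weight of the Riemann tensor are those of a space of constant curvature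
(`IsMetricOn.comp4_riemann_frame`). A quadratic contraction of boost weight `0` pairs components of
opposite boost weights, so it takes its constant curvature value; in particular the square of the
Weyl tensor drops out. Therefore every algebraic term of the field equations is a multiple of `g` in
boost weight `0`, and what remains is `A g + β ε □(w ⊗ w) = 0` in that weight
(`IsMetricOn.comp2_fieldEqLhs_frame`). Let `L_{pi}` be the components of `∇w` along `m_p`, `m_i`, the
first index being that of the derivative, and let `N = ∑ L_{pi}²`. Differentiating `w · w = 0` twice,
the `(l, k)` component reads `A = β ε N`, and the `(m_i, m_i)` component reads
`A + 2 β ε ∑_p L_{pi}² = 0`. Summing the latter over `i` gives `n β ε N = 0`, whence `L = 0`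
(`IsMetricOn.kundt_of_fieldEq`).

Now the divergence `∇^a w_a` reduces to the component `W_{01}` of `∇w`, while the Bianchi identity
says `W_{01} = -∇^a w_a`; both vanish, and `w` is affinely geodetic. Hence `c = √|Φ|` is the required
rescaling, `c^{-2} Φ` is locally constant, and `l` itself is affinely geodetic only if `c` is
constant along it.

All of this takes place in a coordinate chart. The connection and the curvature are treated as
matrix-valued fields, so that the symmetries of the curvature and the Bianchi identities become
identities between commutators. At points where the Weyl tensor vanishes a null frame has to be
constructed (`exists_isNullFrame`).
-/

namespace QuadraticGravity

open Filter Topology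

/-! ### Partial derivatives of scalar and matrix fields -/

section Calculus

variable {n : ℕ} {U : Set (Coord n)} {y : Coord n} {f h : Coord n → ℝ}

theorem differentiableAt_of_contDiffOn (hU : IsOpen U) (hf : ContDiffOn ℝ ∞ f U) (hy : y ∈ U) :
    DifferentiableAt ℝ f y :=
  (hf.contDiffAt (hU.mem_nhds hy)).differentiableAt (by simp)

theorem pd_congr (hfh : f =ᶠ[𝓝 y] h) (a : Fin n) : pd f a y = pd h a y := by
  simp only [pd, hfh.fderiv_eq]

theorem pd_congr_on (hU : IsOpen U) (hy : y ∈ U) (hfh : ∀ z ∈ U, f z = h z) (a : Fin n) :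
    pd f a y = pd h a y :=
  pd_congr (Filter.eventuallyEq_of_mem (hU.mem_nhds hy) hfh) a

@[simp] theorem pd_const (c : ℝ) (a : Fin n) : pd (fun _ => c) a y = 0 := by
  simp [pd]

theorem pd_add (hf : DifferentiableAt ℝ f y) (hh : DifferentiableAt ℝ h y) (a : Fin n) :
    pd (fun z => f z + h z) a y = pd f a y + pd h a y := by
  simp only [pd]
  rw [fderiv_fun_add hf hh]; rfl

theorem pd_neg (f : Coord n → ℝ) (a : Fin n) (y : Coord n) :
    pd (fun z => -f z) a y = -pd f a y := by
  simp only [pd]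
  rw [fderiv_fun_neg]; rfl

theorem pd_sub (hf : DifferentiableAt ℝ f y) (hh : DifferentiableAt ℝ h y) (a : Fin n) :
    pd (fun z => f z - h z) a y = pd f a y - pd h a y := by
  simp only [pd]
  rw [fderiv_fun_sub hf hh]; rfl

theorem pd_mul (hf : DifferentiableAt ℝ f y) (hh : DifferentiableAt ℝ h y) (a : Fin n) :
    pd (fun z => f z * h z) a y = pd f a y * h y + f y * pd h a y := by
  simp only [pd]
  rw [fderiv_fun_mul hf hh]; simp; ring

theorem pd_const_mul (hf : DifferentiableAt ℝ f y) (c : ℝ) (a : Fin n) :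
    pd (fun z => c * f z) a y = c * pd f a y := by
  rw [pd_mul (differentiableAt_const c) hf]; simp

theorem pd_sum {ι : Type*} (s : Finset ι) {F : ι → Coord n → ℝ}
    (hF : ∀ i, DifferentiableAt ℝ (F i) y) (a : Fin n) :
    pd (fun z => ∑ i ∈ s, F i z) a y = ∑ i ∈ s, pd (F i) a y := by
  simp only [pd]
  rw [fderiv_fun_sum (fun i _ => hF i)]; simp

theorem contDiffOn_pd (hU : IsOpen U) (hf : ContDiffOn ℝ ∞ f U) (a : Fin n) :
    ContDiffOn ℝ ∞ (pd f a) U :=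
  (hf.fderiv_of_isOpen hU (m := ∞) (by simp)).clm_apply contDiffOn_const

/-- Partial derivatives commute. -/
theorem pd_comm (hU : IsOpen U) (hf : ContDiffOn ℝ ∞ f U) (hy : y ∈ U) (a b : Fin n) :
    pd (pd f a) b y = pd (pd f b) a y := by
  have hc : ContDiffAt ℝ ∞ f y := hf.contDiffAt (hU.mem_nhds hy)
  have hd : DifferentiableAt ℝ (fderiv ℝ f) y :=
    (hc.fderiv_right (m := ∞) (by simp)).differentiableAt (by simp)
  have key : ∀ a b : Fin n, pd (pd f a) b y =
      fderiv ℝ (fderiv ℝ f) y (EuclideanSpace.single b 1) (EuclideanSpace.single a 1) := by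
    intro a b
    simp only [pd]
    change fderiv ℝ (fun z => fderiv ℝ f z (EuclideanSpace.single a 1)) y _ = _
    rw [fderiv_clm_apply hd (differentiableAt_const _)]
    simp
  rw [key, key]
  have h2 : (2 : WithTop ℕ∞) ≤ ∞ := WithTop.coe_le_coe.2 (le_top (a := (2 : ℕ∞)))
  exact (hc.isSymmSndFDerivAt (by simpa using h2)).eq _ _

/-- A matrix field has smooth components on `U`. -/
def SmoothMat (U : Set (Coord n)) (A : MetricField n) : Prop :=
  ∀ a b, ContDiffOn ℝ ∞ (fun z => A z a b) U

/-- The partial derivative of a matrix field, taken componentwise. -/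
noncomputable def pdMat (A : MetricField n) (c : Fin n) : MetricField n := fun y =>
  Matrix.of fun a b => pd (fun z => A z a b) c y

variable {A B : MetricField n}

theorem SmoothMat.differentiableAt (hU : IsOpen U) (hA : SmoothMat U A) (hy : y ∈ U) (a b : Fin n) :
    DifferentiableAt ℝ (fun z => A z a b) y :=
  differentiableAt_of_contDiffOn hU (hA a b) hy

theorem SmoothMat.pdMat (hU : IsOpen U) (hA : SmoothMat U A) (c : Fin n) :
    SmoothMat U (pdMat A c) := fun a b => contDiffOn_pd hU (hA a b) c

theorem SmoothMat.mul (hA : SmoothMat U A) (hB : SmoothMat U B) :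
    SmoothMat U (fun z => A z * B z) := fun a b => by
  simp only [Matrix.mul_apply]
  exact ContDiffOn.sum fun i _ => (hA a i).mul (hB i b)

theorem SmoothMat.add (hA : SmoothMat U A) (hB : SmoothMat U B) :
    SmoothMat U (fun z => A z + B z) := fun a b => (hA a b).add (hB a b)

theorem SmoothMat.sub (hA : SmoothMat U A) (hB : SmoothMat U B) :
    SmoothMat U (fun z => A z - B z) := fun a b => (hA a b).sub (hB a b)

theorem SmoothMat.transpose (hA : SmoothMat U A) : SmoothMat U (fun z => (A z).transpose) :=
  fun a b => hA b a

theorem pdMat_congr_on (hU : IsOpen U) (hy : y ∈ U) (hAB : ∀ z ∈ U, A z = B z) (c : Fin n) :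
    pdMat A c y = pdMat B c y := by
  ext a b
  exact pd_congr_on hU hy (fun z hz => by rw [hAB z hz]) c

theorem pdMat_add (hU : IsOpen U) (hA : SmoothMat U A) (hB : SmoothMat U B) (hy : y ∈ U)
    (c : Fin n) : pdMat (fun z => A z + B z) c y = pdMat A c y + pdMat B c y := by
  ext a b
  exact pd_add (hA.differentiableAt hU hy a b) (hB.differentiableAt hU hy a b) c

theorem pdMat_sub (hU : IsOpen U) (hA : SmoothMat U A) (hB : SmoothMat U B) (hy : y ∈ U)
    (c : Fin n) : pdMat (fun z => A z - B z) c y = pdMat A c y - pdMat B c y := by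
  ext a b
  exact pd_sub (hA.differentiableAt hU hy a b) (hB.differentiableAt hU hy a b) c

theorem pdMat_neg (A : MetricField n) (c : Fin n) (y : Coord n) :
    pdMat (fun z => -A z) c y = -pdMat A c y := by
  ext a b
  exact pd_neg (fun z => A z a b) c y

theorem pdMat_transpose (c : Fin n) :
    pdMat (fun z => (A z).transpose) c y = (pdMat A c y).transpose := rfl

theorem pdMat_mul (hU : IsOpen U) (hA : SmoothMat U A) (hB : SmoothMat U B) (hy : y ∈ U)
    (c : Fin n) : pdMat (fun z => A z * B z) c y = pdMat A c y * B y + A y * pdMat B c y := by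
  ext a b
  simp only [pdMat, Matrix.mul_apply, Matrix.add_apply, Matrix.of_apply]
  rw [pd_sum _ (F := fun i z => A z a i * B z i b)
    (fun i => (hA.differentiableAt hU hy a i).mul (hB.differentiableAt hU hy i b)),
    ← Finset.sum_add_distrib]
  exact Finset.sum_congr rfl fun i _ =>
    pd_mul (hA.differentiableAt hU hy a i) (hB.differentiableAt hU hy i b) c

theorem pdMat_comm (hU : IsOpen U) (hA : SmoothMat U A) (hy : y ∈ U) (c d : Fin n) :
    pdMat (pdMat A c) d y = pdMat (pdMat A d) c y := by
  ext a b
  exact pd_comm hU (hA a b) hy c d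

theorem contDiffOn_det {m : ℕ} {U : Set (Coord n)} {A : Coord n → Matrix (Fin m) (Fin m) ℝ}
    (hA : ∀ a b, ContDiffOn ℝ ∞ (fun z => A z a b) U) :
    ContDiffOn ℝ ∞ (fun z => (A z).det) U := by
  simp only [Matrix.det_apply']
  exact ContDiffOn.sum fun σ _ => contDiffOn_const.mul (contDiffOn_prod fun i _ => hA _ _)

theorem SmoothMat.inv (hA : SmoothMat U A) (hdet : ∀ z ∈ U, (A z).det ≠ 0) :
    SmoothMat U (fun z => (A z)⁻¹) := fun a b => by
  have h1 : ∀ z, (A z)⁻¹ a b = ((A z).det)⁻¹ * (A z).adjugate a b := fun z => by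
    simp [Matrix.inv_def, Ring.inverse_eq_inv']
  simp only [h1, Matrix.adjugate_apply]
  refine ((contDiffOn_det hA).inv hdet).mul (contDiffOn_det fun i j => ?_)
  by_cases hi : i = b
  · subst hi; simp only [Matrix.updateRow_self]; exact contDiffOn_const
  · simp only [Matrix.updateRow_ne hi]; exact hA i j

end Calculus

/-! ### Connection and curvature as matrix fields -/

/-- `G` is a smooth, symmetric and nondegenerate metric on the open set `U` of coordinate space. -/
structure IsMetricOn (G : MetricField n) (U : Set (Coord n)) : Prop where
  isOpen : IsOpen U
  symm : ∀ z a b, G z a b = G z b a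
  det_ne : ∀ z ∈ U, (G z).det ≠ 0
  smooth : SmoothMat U G

/-- The connection matrix `(Γ_c)^a_b = Γ^a_{cb}`. -/
noncomputable def conn (G : MetricField n) (c : Fin n) : MetricField n := fun y =>
  Matrix.of fun a b => christoffel G y a c b

/-- The curvature matrix `(R_{cd})^a_b = R^a_{bcd}`. -/
noncomputable def curv (G : MetricField n) (c d : Fin n) : MetricField n := fun y =>
  Matrix.of fun a b => riemannUp G y a b c d

section Connection

variable {n : ℕ} {G : MetricField n} {U : Set (Coord n)} {y : Coord n}

theorem christoffel_comm (hs : ∀ z a b, G z a b = G z b a) (y : Coord n) (a b c : Fin n) :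
    christoffel G y a b c = christoffel G y a c b := by
  simp only [christoffel]
  congr 1
  refine Finset.sum_congr rfl fun d _ => ?_
  simp only [hs _ b c]
  ring

theorem IsMetricOn.transpose (hG : IsMetricOn G U) (z : Coord n) : (G z).transpose = G z := by
  ext a b; exact hG.symm z b a

theorem IsMetricOn.isUnit_det (hG : IsMetricOn G U) (hy : y ∈ U) : IsUnit (G y).det :=
  isUnit_iff_ne_zero.2 (hG.det_ne y hy)

theorem IsMetricOn.smooth_inv (hG : IsMetricOn G U) : SmoothMat U (fun z => (G z)⁻¹) :=
  hG.smooth.inv hG.det_ne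

theorem IsMetricOn.ginv_comm (hG : IsMetricOn G U) (z : Coord n) (a b : Fin n) :
    ginv G z a b = ginv G z b a := by
  have h := Matrix.transpose_nonsing_inv (G z)
  rw [hG.transpose] at h
  exact congrFun (congrFun h b) a

theorem IsMetricOn.sum_mul_ginv (hG : IsMetricOn G U) (hy : y ∈ U) (a c : Fin n) :
    ∑ b, G y a b * ginv G y b c = if a = c then 1 else 0 := by
  have h := Matrix.mul_nonsing_inv (G y) (hG.isUnit_det hy)
  have h2 := congrFun (congrFun h a) c
  rwa [Matrix.mul_apply, Matrix.one_apply] at h2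

theorem IsMetricOn.sum_ginv_mul (hG : IsMetricOn G U) (hy : y ∈ U) (a c : Fin n) :
    ∑ b, ginv G y a b * G y b c = if a = c then 1 else 0 := by
  have h := Matrix.nonsing_inv_mul (G y) (hG.isUnit_det hy)
  have h2 := congrFun (congrFun h a) c
  rwa [Matrix.mul_apply, Matrix.one_apply] at h2

theorem IsMetricOn.smooth_conn (hG : IsMetricOn G U) (c : Fin n) : SmoothMat U (conn G c) := by
  intro a b
  have hpd : ∀ i j k, ContDiffOn ℝ ∞ (fun y => pd (fun z => G z i j) k y) U := fun i j k =>
    contDiffOn_pd hG.isOpen (hG.smooth i j) k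
  simp only [conn, Matrix.of_apply, christoffel]
  exact contDiffOn_const.mul (ContDiffOn.sum fun d _ => (hG.smooth_inv a d).mul
    (((hpd _ _ _).add (hpd _ _ _)).sub (hpd _ _ _)))

theorem IsMetricOn.sum_mul_christoffel (hG : IsMetricOn G U) (hy : y ∈ U) (e b c : Fin n) :
    ∑ a, G y e a * christoffel G y a b c = (1 / 2) *
      (pd (fun z => G z e c) b y + pd (fun z => G z e b) c y - pd (fun z => G z b c) e y) := by
  simp only [christoffel, Finset.mul_sum]
  rw [Finset.sum_comm]
  have h : ∀ d, ∑ a, G y e a * (1 / 2 * (ginv G y a d *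
      (pd (fun z => G z d c) b y + pd (fun z => G z d b) c y - pd (fun z => G z b c) d y))) =
      (if e = d then 1 else 0) * (1 / 2 *
      (pd (fun z => G z d c) b y + pd (fun z => G z d b) c y - pd (fun z => G z b c) d y)) := by
    intro d
    rw [← hG.sum_mul_ginv hy e d, Finset.sum_mul]
    exact Finset.sum_congr rfl fun a _ => by ring
  simp only [h]
  simp

/-- The Levi-Civita connection is metric: `∂_c G = Γ_cᵀ G + G Γ_c`. -/
theorem IsMetricOn.pdMat_metric (hG : IsMetricOn G U) (hy : y ∈ U) (c : Fin n) :
    pdMat G c y = (conn G c y).transpose * G y + G y * conn G c y := by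
  ext a b
  have h1 := hG.sum_mul_christoffel hy a c b
  have h2 := hG.sum_mul_christoffel hy b c a
  simp only [Matrix.add_apply, Matrix.mul_apply, conn, pdMat, Matrix.of_apply,
    Matrix.transpose_apply]
  have h3 : ∑ j, christoffel G y j c a * G y j b = ∑ j, G y b j * christoffel G y j c a :=
    Finset.sum_congr rfl fun j _ => by rw [hG.symm y b j]; ring
  rw [h1, h3, h2]
  have e1 : (fun z => G z b a) = fun z => G z a b := funext fun z => hG.symm z b a
  have e2 : (fun z => G z c b) = fun z => G z b c := funext fun z => hG.symm z c b
  have e3 : (fun z => G z c a) = fun z => G z a c := funext fun z => hG.symm z c a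
  rw [e1, e2, e3]; ring

theorem IsMetricOn.pdMat_inv (hG : IsMetricOn G U) (hy : y ∈ U) (c : Fin n) :
    pdMat (fun z => (G z)⁻¹) c y =
      -((G y)⁻¹ * (conn G c y).transpose) - conn G c y * (G y)⁻¹ := by
  have h0 : pdMat (fun z => (G z)⁻¹ * G z) c y = 0 := by
    rw [pdMat_congr_on (B := fun _ => 1) hG.isOpen hy
      (fun z hz => Matrix.nonsing_inv_mul _ (hG.isUnit_det hz))]
    ext a b; simp [pdMat]
  rw [pdMat_mul hG.isOpen hG.smooth_inv hG.smooth hy, hG.pdMat_metric hy] at h0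
  have hu := Matrix.mul_nonsing_inv (G y) (hG.isUnit_det hy)
  have hv := Matrix.nonsing_inv_mul (G y) (hG.isUnit_det hy)
  have h1 := congrArg (· * (G y)⁻¹) h0
  simp only [Matrix.add_mul, Matrix.mul_add, zero_mul] at h1
  rw [Matrix.mul_assoc, hu, Matrix.mul_one, ← Matrix.mul_assoc (G y)⁻¹ (G y), hv, Matrix.one_mul,
    ← Matrix.mul_assoc (G y)⁻¹, Matrix.mul_assoc _ (G y), hu, Matrix.mul_one] at h1
  rw [sub_eq_add_neg, ← neg_add]
  exact eq_neg_of_add_eq_zero_left h1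

theorem IsMetricOn.curv_eq (hG : IsMetricOn G U) (y : Coord n) (c d : Fin n) :
    curv G c d y = pdMat (conn G d) c y - pdMat (conn G c) d y
      + (conn G c y * conn G d y - conn G d y * conn G c y) := by
  ext a b
  simp only [curv, riemannUp, conn, pdMat, Matrix.add_apply, Matrix.sub_apply, Matrix.mul_apply,
    Matrix.of_apply, Finset.sum_sub_distrib]
  simp only [christoffel_comm hG.symm _ _ b]

theorem IsMetricOn.smooth_curv (hG : IsMetricOn G U) (c d : Fin n) : SmoothMat U (curv G c d) := by
  have h : curv G c d = fun y => pdMat (conn G d) c y - pdMat (conn G c) d y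
      + (conn G c y * conn G d y - conn G d y * conn G c y) := funext fun y => hG.curv_eq y c d
  rw [h]
  have hc := hG.smooth_conn
  exact (((hc d).pdMat hG.isOpen c).sub ((hc c).pdMat hG.isOpen d)).add
    (((hc c).mul (hc d)).sub ((hc d).mul (hc c)))

theorem curv_antisymm (c d : Fin n) (y : Coord n) : curv G c d y = -curv G d c y := by
  ext a b
  simp only [curv, riemannUp, Matrix.neg_apply, Matrix.of_apply, Finset.sum_sub_distrib]
  ring

/-- Antisymmetry of `R_{abcd}` in the first pair of indices, from `[∂_c, ∂_d] G = 0`. -/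
theorem IsMetricOn.lower_curv_antisymm (hG : IsMetricOn G U) (hy : y ∈ U) (c d : Fin n) :
    (G y * curv G c d y).transpose = -(G y * curv G c d y) := by
  have hc := hG.smooth_conn
  have key : ∀ c d, pdMat (pdMat G d) c y =
      (pdMat (conn G d) c y).transpose * G y
        + (conn G d y).transpose * ((conn G c y).transpose * G y + G y * conn G c y)
        + (((conn G c y).transpose * G y + G y * conn G c y) * conn G d y
          + G y * pdMat (conn G d) c y) := by
    intro c d
    rw [pdMat_congr_on hG.isOpen hy (fun z hz => hG.pdMat_metric hz d),
      pdMat_add hG.isOpen ((hc d).transpose.mul hG.smooth) (hG.smooth.mul (hc d)) hy,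
      pdMat_mul hG.isOpen (hc d).transpose hG.smooth hy,
      pdMat_mul hG.isOpen hG.smooth (hc d) hy, pdMat_transpose, hG.pdMat_metric hy]
  have h := pdMat_comm hG.isOpen hG.smooth hy d c
  rw [key, key] at h
  rw [hG.curv_eq]
  simp only [Matrix.transpose_mul, Matrix.transpose_add, Matrix.transpose_sub, hG.transpose]
  rw [eq_neg_iff_add_eq_zero]
  rw [← sub_eq_zero] at h
  rw [← h]
  noncomm_ring

/-- The gauge-covariant derivative `∂_f R_{cd} + [Γ_f, R_{cd}]` of the curvature matrices. -/
noncomputable def dCurv (G : MetricField n) (f c d : Fin n) (y : Coord n) : Matrix (Fin n) (Fin n) ℝ :=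
  pdMat (curv G c d) f y + conn G f y * curv G c d y - curv G c d y * conn G f y

theorem dCurv_antisymm (f c d : Fin n) (y : Coord n) : dCurv G f c d y = -dCurv G f d c y := by
  have h : pdMat (curv G c d) f y = -pdMat (curv G d c) f y := by
    rw [← pdMat_neg]
    exact congrArg (pdMat · f y) (funext (curv_antisymm c d))
  simp only [dCurv, h, curv_antisymm c d y]
  noncomm_ring

/-- The second Bianchi identity, in terms of connection matrices a consequence of the Jacobi
identity. -/
theorem IsMetricOn.dCurv_cyclic (hG : IsMetricOn G U) (hy : y ∈ U) (f c d : Fin n) :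
    dCurv G f c d y + dCurv G c d f y + dCurv G d f c y = 0 := by
  have hc := hG.smooth_conn
  have ho := hG.isOpen
  have key : ∀ f c d, pdMat (curv G c d) f y =
      pdMat (pdMat (conn G d) c) f y - pdMat (pdMat (conn G c) d) f y
      + (pdMat (conn G c) f y * conn G d y + conn G c y * pdMat (conn G d) f y
        - (pdMat (conn G d) f y * conn G c y + conn G d y * pdMat (conn G c) f y)) := by
    intro f c d
    rw [pdMat_congr_on ho hy (fun z _ => hG.curv_eq z c d),
      pdMat_add ho (((hc d).pdMat ho c).sub ((hc c).pdMat ho d))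
        (((hc c).mul (hc d)).sub ((hc d).mul (hc c))) hy,
      pdMat_sub ho ((hc d).pdMat ho c) ((hc c).pdMat ho d) hy,
      pdMat_sub ho ((hc c).mul (hc d)) ((hc d).mul (hc c)) hy,
      pdMat_mul ho (hc c) (hc d) hy, pdMat_mul ho (hc d) (hc c) hy]
  simp only [dCurv, key, hG.curv_eq]
  rw [pdMat_comm ho (hc d) hy c f, pdMat_comm ho (hc c) hy d f, pdMat_comm ho (hc f) hy c d]
  noncomm_ring

/-- Covariant differentiation preserves the antisymmetry of `R_{abcd}` in `a`, `b`. -/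
theorem IsMetricOn.lower_dCurv_antisymm (hG : IsMetricOn G U) (hy : y ∈ U) (f c d : Fin n) :
    (G y * dCurv G f c d y).transpose = -(G y * dCurv G f c d y) := by
  have hA := hG.lower_curv_antisymm hy c d
  have h1 : (pdMat (fun z => G z * curv G c d z) f y).transpose =
      -pdMat (fun z => G z * curv G c d z) f y := by
    rw [← pdMat_transpose, pdMat_congr_on hG.isOpen hy (fun z hz => hG.lower_curv_antisymm hz c d),
      pdMat_neg]
  rw [pdMat_mul hG.isOpen hG.smooth (hG.smooth_curv c d) hy, hG.pdMat_metric hy] at h1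
  have e : G y * dCurv G f c d y =
      ((conn G f y).transpose * G y + G y * conn G f y) * curv G c d y
        + G y * pdMat (curv G c d) f y
      - ((conn G f y).transpose * (G y * curv G c d y) + G y * curv G c d y * conn G f y) := by
    rw [dCurv]; noncomm_ring
  rw [e, Matrix.transpose_sub, h1, Matrix.transpose_add, Matrix.transpose_mul,
    Matrix.transpose_mul _ (conn G f y), hA, Matrix.transpose_transpose]
  noncomm_ring

end Connection

/-! ### The contracted Bianchi identity -/

section Bianchi

variable {n : ℕ} {G : MetricField n} {U : Set (Coord n)} {y : Coord n}

/-- The matrices `(∇_f R_{cd})^a_b = ∇_f R^a_{bcd}`. -/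
noncomputable def nablaCurv (G : MetricField n) (f c d : Fin n) (y : Coord n) :
    Matrix (Fin n) (Fin n) ℝ :=
  dCurv G f c d y - ∑ e, christoffel G y e f c • curv G e d y
    - ∑ e, christoffel G y e f d • curv G c e y

theorem nablaCurv_antisymm (f c d : Fin n) (y : Coord n) :
    nablaCurv G f c d y = -nablaCurv G f d c y := by
  have h1 : ∀ a b, ∑ e, christoffel G y e f a • curv G b e y
      = -∑ e, christoffel G y e f a • curv G e b y := by
    intro a b
    rw [← Finset.sum_neg_distrib]
    exact Finset.sum_congr rfl fun e _ => by rw [curv_antisymm b e, smul_neg]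
  rw [nablaCurv, nablaCurv, dCurv_antisymm f c d, h1, h1]
  abel

theorem IsMetricOn.nablaCurv_cyclic (hG : IsMetricOn G U) (hy : y ∈ U) (f c d : Fin n) :
    nablaCurv G f c d y + nablaCurv G c d f y + nablaCurv G d f c y = 0 := by
  have h1 : ∀ f a b, ∑ e, christoffel G y e f a • curv G b e y
      = -∑ e, christoffel G y e f a • curv G e b y := by
    intro f a b
    rw [← Finset.sum_neg_distrib]
    exact Finset.sum_congr rfl fun e _ => by rw [curv_antisymm b e, smul_neg]
  simp only [nablaCurv, h1]
  simp only [christoffel_comm hG.symm y _ d, christoffel_comm hG.symm y _ c f]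
  rw [← hG.dCurv_cyclic hy f c d]
  abel

theorem IsMetricOn.lower_nablaCurv_antisymm (hG : IsMetricOn G U) (hy : y ∈ U) (f c d : Fin n) :
    (G y * nablaCurv G f c d y).transpose = -(G y * nablaCurv G f c d y) := by
  simp only [nablaCurv, Matrix.mul_sub, Matrix.mul_sum, Matrix.mul_smul, Matrix.transpose_sub,
    Matrix.transpose_sum, Matrix.transpose_smul, hG.lower_dCurv_antisymm hy,
    hG.lower_curv_antisymm hy, smul_neg, Finset.sum_neg_distrib]
  abel

/-- Contraction commutes with covariant differentiation: `∇_f R^a_{bad} = ∇_f R_{bd}`. -/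
theorem IsMetricOn.trace_nablaCurv (hG : IsMetricOn G U) (hy : y ∈ U) (f b d : Fin n) :
    ∑ a, nablaCurv G f a d y a b = nabla2 G (ricci G) y f b d := by
  have hpd : pd (fun z => ricci G z b d) f y = ∑ a, pd (fun z => curv G a d z a b) f y := by
    simp only [ricci]
    exact pd_sum _ (F := fun a z => riemannUp G z a b a d)
      (fun a => (hG.smooth_curv a d).differentiableAt hG.isOpen hy a b) f
  simp only [nablaCurv, dCurv, Matrix.sub_apply, Matrix.add_apply, Matrix.mul_apply,
    Matrix.sum_apply, Matrix.smul_apply, smul_eq_mul, pdMat, Matrix.of_apply,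
    Finset.sum_sub_distrib, Finset.sum_add_distrib, nabla2, hpd]
  have h1 : ∑ a, ∑ e, conn G f y a e * curv G a d y e b
      = ∑ a, ∑ e, christoffel G y e f a * curv G e d y a b := by
    rw [Finset.sum_comm]; rfl
  have h2 : ∑ a, ∑ e, curv G a d y a e * conn G f y e b
      = ∑ e, christoffel G y e f b * ricci G y e d := by
    rw [Finset.sum_comm]
    refine Finset.sum_congr rfl fun e _ => ?_
    rw [ricci, Finset.mul_sum]
    exact Finset.sum_congr rfl fun a _ => mul_comm _ _
  have h3 : ∑ a, ∑ e, christoffel G y e f d * curv G a e y a b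
      = ∑ e, christoffel G y e f d * ricci G y b e := by
    rw [Finset.sum_comm]
    refine Finset.sum_congr rfl fun e _ => ?_
    rw [ricci, Finset.mul_sum]
    rfl
  rw [h1, h2, h3]
  ring

/-- The contracted Bianchi identity `g^{bd} ∇_f R_{bd} = 2 g^{bd} ∇_d R_{bf}`. -/
theorem IsMetricOn.contracted_bianchi (hG : IsMetricOn G U) (hy : y ∈ U) (f : Fin n) :
    ∑ b, ∑ d, ginv G y b d * nabla2 G (ricci G) y f b d
      = 2 * ∑ b, ∑ d, ginv G y b d * nabla2 G (ricci G) y d b f := by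
  have hcyc : ∀ b d, nabla2 G (ricci G) y f b d + ∑ a, nablaCurv G a d f y a b
      - nabla2 G (ricci G) y d b f = 0 := by
    intro b d
    rw [← hG.trace_nablaCurv hy, ← hG.trace_nablaCurv hy, ← Finset.sum_add_distrib,
      ← Finset.sum_sub_distrib]
    refine Finset.sum_eq_zero fun a _ => ?_
    have h := congrFun (congrFun (hG.nablaCurv_cyclic hy f a d) a) b
    rw [nablaCurv_antisymm d f a] at h
    simp only [Matrix.add_apply, Matrix.neg_apply, Matrix.zero_apply] at h
    linarith
  -- Raising the second index of `∇R` gives a matrix which is again antisymmetric.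
  have hanti : ∀ a d, (nablaCurv G a d f y * (G y)⁻¹) a d
      = -(nablaCurv G a d f y * (G y)⁻¹) d a := by
    intro a d
    have hu := Matrix.mul_nonsing_inv (G y) (hG.isUnit_det hy)
    have hv := Matrix.nonsing_inv_mul (G y) (hG.isUnit_det hy)
    have hT : (nablaCurv G a d f y * (G y)⁻¹).transpose = -(nablaCurv G a d f y * (G y)⁻¹) := by
      have e : nablaCurv G a d f y * (G y)⁻¹ =
          (G y)⁻¹ * (G y * nablaCurv G a d f y) * (G y)⁻¹ := by
        rw [← Matrix.mul_assoc, hv, Matrix.one_mul]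
      rw [e, Matrix.transpose_mul, Matrix.transpose_mul, hG.lower_nablaCurv_antisymm hy,
        Matrix.transpose_nonsing_inv, hG.transpose]
      simp only [Matrix.neg_mul, Matrix.mul_neg, Matrix.mul_assoc]
    have := congrFun (congrFun hT d) a
    simpa using this
  have hmid : ∑ b, ∑ d, ginv G y b d * ∑ a, nablaCurv G a d f y a b
      = -∑ b, ∑ d, ginv G y b d * nabla2 G (ricci G) y d b f := by
    have e1 : ∑ b, ∑ d, ginv G y b d * ∑ a, nablaCurv G a d f y a b
        = ∑ d, ∑ a, (nablaCurv G a d f y * (G y)⁻¹) a d := by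
      rw [Finset.sum_comm]
      refine Finset.sum_congr rfl fun d _ => ?_
      simp only [Matrix.mul_apply, Finset.mul_sum]
      rw [Finset.sum_comm]
      exact Finset.sum_congr rfl fun a _ => Finset.sum_congr rfl fun b _ => mul_comm _ _
    rw [e1]
    simp only [hanti, Finset.sum_neg_distrib]
    congr 1
    rw [Finset.sum_comm]
    conv_rhs => rw [Finset.sum_comm]
    refine Finset.sum_congr rfl fun a _ => ?_
    simp only [Matrix.mul_apply, ← hG.trace_nablaCurv hy, Finset.mul_sum]
    rw [Finset.sum_comm]
    exact Finset.sum_congr rfl fun a _ => Finset.sum_congr rfl fun b _ => mul_comm _ _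
  have hsum : ∑ b, ∑ d, ginv G y b d * (nabla2 G (ricci G) y f b d
      + ∑ a, nablaCurv G a d f y a b - nabla2 G (ricci G) y d b f) = 0 := by
    simp only [hcyc, mul_zero, Finset.sum_const_zero]
  simp only [mul_add, mul_sub, Finset.sum_add_distrib, Finset.sum_sub_distrib, hmid] at hsum
  linarith

end Bianchi

/-! ### Covariant derivatives of a null covector field -/

section NullField

variable {n : ℕ} {G : MetricField n} {U : Set (Coord n)} {y : Coord n}

/-- A covector field has smooth components on `U`. -/
def SmoothVec (U : Set (Coord n)) (p : Field1 n) : Prop := ∀ a, ContDiffOn ℝ ∞ (fun z => p z a) U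

theorem IsMetricOn.smooth_nabla1 (hG : IsMetricOn G U) {p : Field1 n} (hp : SmoothVec U p)
    (c : Fin n) : SmoothVec U (fun z => nabla1 G p z c) := fun a =>
  (contDiffOn_pd hG.isOpen (hp a) c).sub
    (ContDiffOn.sum fun d _ => (hG.smooth_conn c d a).mul (hp d))

/-- The scalar product of two covectors. -/
noncomputable def codot (G : MetricField n) (y : Coord n) (p q : Fin n → ℝ) : ℝ :=
  ∑ a, ∑ b, ginv G y a b * p a * q b

theorem IsMetricOn.codot_comm (hG : IsMetricOn G U) (p q : Fin n → ℝ) :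
    codot G y p q = codot G y q p := by
  simp only [codot]
  rw [Finset.sum_comm]
  exact Finset.sum_congr rfl fun _ _ => Finset.sum_congr rfl fun _ _ => by
    rw [hG.ginv_comm]; ring

/-- Leibniz rule for the scalar product of two covector fields. -/
theorem IsMetricOn.pd_contract (hG : IsMetricOn G U) (hy : y ∈ U) {p q : Field1 n}
    (hp : SmoothVec U p) (hq : SmoothVec U q) (c : Fin n) :
    pd (fun z => codot G z (p z) (q z)) c y =
      codot G y (nabla1 G p y c) (q y) + codot G y (p y) (nabla1 G q y c) := by
  simp only [codot]
  have dg : ∀ a b, DifferentiableAt ℝ (fun z => ginv G z a b) y := fun a b =>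
    hG.smooth_inv.differentiableAt hG.isOpen hy a b
  have dp : ∀ a, DifferentiableAt ℝ (fun z => p z a) y := fun a =>
    differentiableAt_of_contDiffOn hG.isOpen (hp a) hy
  have dq : ∀ a, DifferentiableAt ℝ (fun z => q z a) y := fun a =>
    differentiableAt_of_contDiffOn hG.isOpen (hq a) hy
  have hginv : ∀ a b, pd (fun z => ginv G z a b) c y =
      -(∑ e, ginv G y a e * christoffel G y b c e) - ∑ e, christoffel G y a c e * ginv G y e b := by
    intro a b
    have h := congrFun (congrFun (hG.pdMat_inv hy c) a) b
    simp only [Matrix.sub_apply, Matrix.neg_apply, Matrix.mul_apply] at h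
    exact h
  rw [pd_sum _ (F := fun a z => ∑ b, ginv G z a b * p z a * q z b) (fun a =>
    DifferentiableAt.fun_sum fun b _ => ((dg a b).mul (dp a)).mul (dq b))]
  have h1 : ∀ a, pd (fun z => ∑ b, ginv G z a b * p z a * q z b) c y = ∑ b,
      ((pd (fun z => ginv G z a b) c y * p y a + ginv G y a b * pd (fun z => p z a) c y) * q y b
        + ginv G y a b * p y a * pd (fun z => q z b) c y) := by
    intro a
    rw [pd_sum _ (F := fun b z => ginv G z a b * p z a * q z b) (fun b =>
      ((dg a b).mul (dp a)).mul (dq b))]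
    refine Finset.sum_congr rfl fun b _ => ?_
    rw [pd_mul (f := fun z => ginv G z a b * p z a) ((dg a b).mul (dp a)) (dq b),
      pd_mul (dg a b) (dp a)]
  simp only [h1, hginv, nabla1]
  have k1 : ∑ a, ∑ b, (∑ e, ginv G y a e * christoffel G y b c e) * p y a * q y b
      = ∑ a, ∑ b, ginv G y a b * p y a * ∑ d, christoffel G y d c b * q y d := by
    refine Finset.sum_congr rfl fun a _ => ?_
    simp only [Finset.sum_mul, Finset.mul_sum]
    rw [Finset.sum_comm]
    exact Finset.sum_congr rfl fun _ _ => Finset.sum_congr rfl fun _ _ => by ring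
  have k2 : ∑ a, ∑ b, (∑ e, christoffel G y a c e * ginv G y e b) * p y a * q y b
      = ∑ a, ∑ b, ginv G y a b * (∑ d, christoffel G y d c a * p y d) * q y b := by
    rw [Finset.sum_comm]
    conv_rhs => rw [Finset.sum_comm]
    refine Finset.sum_congr rfl fun b _ => ?_
    simp only [Finset.sum_mul, Finset.mul_sum]
    rw [Finset.sum_comm]
    exact Finset.sum_congr rfl fun _ _ => Finset.sum_congr rfl fun _ _ => by ring
  have e : ∀ a b, ((-(∑ e, ginv G y a e * christoffel G y b c e)
        - ∑ e, christoffel G y a c e * ginv G y e b) * p y a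
        + ginv G y a b * pd (fun z => p z a) c y) * q y b
        + ginv G y a b * p y a * pd (fun z => q z b) c y
      = ginv G y a b * pd (fun z => p z a) c y * q y b
        + ginv G y a b * p y a * pd (fun z => q z b) c y
        - (∑ e, ginv G y a e * christoffel G y b c e) * p y a * q y b
        - (∑ e, christoffel G y a c e * ginv G y e b) * p y a * q y b := fun a b => by ring
  simp only [e]
  simp only [mul_sub, sub_mul, Finset.sum_add_distrib, Finset.sum_sub_distrib, k1, k2]
  ring

/-- A null covector is orthogonal to its covariant derivatives. -/
theorem IsMetricOn.codot_nabla1 (hG : IsMetricOn G U) (hy : y ∈ U) {w : Field1 n}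
    (hw : SmoothVec U w) (h0 : ∀ z ∈ U, codot G z (w z) (w z) = 0) (c : Fin n) :
    codot G y (w y) (nabla1 G w y c) = 0 := by
  have h := hG.pd_contract hy hw hw c
  rw [pd_congr_on (h := fun _ => 0) hG.isOpen hy h0, pd_const] at h
  have h2 := hG.codot_comm (y := y) (nabla1 G w y c) (w y)
  linarith

/-- Differentiating `w · ∇_c w = 0` once more. -/
theorem IsMetricOn.codot_nabla2 (hG : IsMetricOn G U) (hy : y ∈ U) {w : Field1 n}
    (hw : SmoothVec U w) (h0 : ∀ z ∈ U, codot G z (w z) (w z) = 0) (c d : Fin n) :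
    codot G y (w y) (nabla2 G (nabla1 G w) y d c) =
      -codot G y (nabla1 G w y d) (nabla1 G w y c) := by
  have h := hG.pd_contract hy hw (hG.smooth_nabla1 hw c) d
  rw [pd_congr_on (h := fun _ => 0) hG.isOpen hy (fun z hz => hG.codot_nabla1 hz hw h0 c),
    pd_const] at h
  have e : ∀ b, nabla1 G (fun z => nabla1 G w z c) y d b =
      nabla2 G (nabla1 G w) y d c b + ∑ e, christoffel G y e d c * nabla1 G w y e b := by
    intro b
    conv_lhs => rw [nabla1]
    simp only [nabla2, Finset.sum_add_distrib]
    ring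
  have h3 : ∑ a, ∑ b, ginv G y a b * w y a * ∑ e, christoffel G y e d c * nabla1 G w y e b = 0 := by
    have : ∑ a, ∑ b, ginv G y a b * w y a * ∑ e, christoffel G y e d c * nabla1 G w y e b
        = ∑ e, christoffel G y e d c * codot G y (w y) (nabla1 G w y e) := by
      simp only [codot, Finset.mul_sum]
      rw [Finset.sum_congr rfl fun a _ => Finset.sum_comm, Finset.sum_comm]
      exact Finset.sum_congr rfl fun _ _ => Finset.sum_congr rfl fun _ _ =>
        Finset.sum_congr rfl fun _ _ => by ring
    rw [this]
    exact Finset.sum_eq_zero fun e _ => by rw [hG.codot_nabla1 hy hw h0, mul_zero]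
  simp only [codot, e] at h ⊢
  simp only [mul_add, Finset.sum_add_distrib, h3] at h
  linarith

/-- `∇_c (μ g_{ab} + ε w_a w_b)`. -/
theorem IsMetricOn.nabla2_radiation (hG : IsMetricOn G U) (hy : y ∈ U) {w : Field1 n}
    (hw : SmoothVec U w) {T : Field2 n} {μ ε : ℝ}
    (hT : ∀ z ∈ U, ∀ a b, T z a b = μ * G z a b + ε * (w z a * w z b)) (c a b : Fin n) :
    nabla2 G T y c a b = ε * (nabla1 G w y c a * w y b + w y a * nabla1 G w y c b) := by
  have dw : ∀ a, DifferentiableAt ℝ (fun z => w z a) y := fun a =>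
    differentiableAt_of_contDiffOn hG.isOpen (hw a) hy
  have dG := hG.smooth.differentiableAt hG.isOpen hy
  have hpd : pd (fun z => T z a b) c y = μ * pd (fun z => G z a b) c y
      + ε * (pd (fun z => w z a) c y * w y b + w y a * pd (fun z => w z b) c y) := by
    rw [pd_congr_on hG.isOpen hy (fun z hz => hT z hz a b),
      pd_add (f := fun z => μ * G z a b) (h := fun z => ε * (w z a * w z b))
        ((dG a b).const_mul μ) (((dw a).mul (dw b)).const_mul ε),
      pd_const_mul (dG a b), pd_const_mul (f := fun z => w z a * w z b) ((dw a).mul (dw b)),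
      pd_mul (dw a) (dw b)]
  have hg := congrFun (congrFun (hG.pdMat_metric hy c) a) b
  simp only [Matrix.add_apply, Matrix.mul_apply, conn, pdMat, Matrix.of_apply,
    Matrix.transpose_apply] at hg
  simp only [nabla2, nabla1, hpd, hg, hT y hy]
  have e : ∀ d, christoffel G y d c a * (μ * G y d b + ε * (w y d * w y b))
      + christoffel G y d c b * (μ * G y a d + ε * (w y a * w y d))
      = μ * (christoffel G y d c a * G y d b) + μ * (G y a d * christoffel G y d c b)
        + ε * (christoffel G y d c a * w y d) * w y b
        + ε * w y a * (christoffel G y d c b * w y d) := fun d => by ring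
  simp only [e, Finset.sum_add_distrib, ← Finset.mul_sum, ← Finset.sum_mul]
  ring

/-- The second covariant derivative of `μ g_{ab} + ε w_a w_b`. -/
theorem IsMetricOn.nabla3_radiation (hG : IsMetricOn G U) (hy : y ∈ U) {w : Field1 n}
    (hw : SmoothVec U w) {T : Field2 n} {μ ε : ℝ}
    (hT : ∀ z ∈ U, ∀ a b, T z a b = μ * G z a b + ε * (w z a * w z b)) (d c a b : Fin n) :
    nabla3 G (nabla2 G T) y d c a b =
      ε * (nabla2 G (nabla1 G w) y d c a * w y b + w y a * nabla2 G (nabla1 G w) y d c b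
        + nabla1 G w y c a * nabla1 G w y d b + nabla1 G w y d a * nabla1 G w y c b) := by
  have dw : ∀ a, DifferentiableAt ℝ (fun z => w z a) y := fun a =>
    differentiableAt_of_contDiffOn hG.isOpen (hw a) hy
  have dW : ∀ c a, DifferentiableAt ℝ (fun z => nabla1 G w z c a) y := fun c a =>
    differentiableAt_of_contDiffOn hG.isOpen (hG.smooth_nabla1 hw c a) hy
  have hS := fun z (hz : z ∈ U) => hG.nabla2_radiation hz hw hT
  have hpd : pd (fun z => nabla2 G T z c a b) d y =
      ε * ((pd (fun z => nabla1 G w z c a) d y * w y b + nabla1 G w y c a * pd (fun z => w z b) d y)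
        + (pd (fun z => w z a) d y * nabla1 G w y c b
          + w y a * pd (fun z => nabla1 G w z c b) d y)) := by
    rw [pd_congr_on hG.isOpen hy (fun z hz => hS z hz c a b),
      pd_const_mul (f := fun z => nabla1 G w z c a * w z b + w z a * nabla1 G w z c b)
        (((dW c a).mul (dw b)).add ((dw a).mul (dW c b))),
      pd_add (f := fun z => nabla1 G w z c a * w z b) (h := fun z => w z a * nabla1 G w z c b)
        ((dW c a).mul (dw b)) ((dw a).mul (dW c b)),
      pd_mul (dW c a) (dw b), pd_mul (dw a) (dW c b)]
  have hw1 : ∀ a d, pd (fun z => w z a) d y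
      = nabla1 G w y d a + ∑ e, christoffel G y e d a * w y e := by
    intro a d; simp only [nabla1]; ring
  have hW1 : ∀ a, pd (fun z => nabla1 G w z c a) d y
      = nabla2 G (nabla1 G w) y d c a + (∑ e, christoffel G y e d c * nabla1 G w y e a
        + ∑ e, christoffel G y e d a * nabla1 G w y c e) := by
    intro a; simp only [nabla2, Finset.sum_add_distrib]; ring
  rw [nabla3, hpd]
  simp only [hw1, hW1, hS y hy]
  have e : ∀ e, christoffel G y e d c * (ε * (nabla1 G w y e a * w y b + w y a * nabla1 G w y e b))
      + christoffel G y e d a * (ε * (nabla1 G w y c e * w y b + w y e * nabla1 G w y c b))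
      + christoffel G y e d b * (ε * (nabla1 G w y c a * w y e + w y a * nabla1 G w y c e))
      = ε * (christoffel G y e d c * nabla1 G w y e a) * w y b
        + ε * w y a * (christoffel G y e d c * nabla1 G w y e b)
        + ε * (christoffel G y e d a * nabla1 G w y c e) * w y b
        + ε * (christoffel G y e d a * w y e) * nabla1 G w y c b
        + ε * nabla1 G w y c a * (christoffel G y e d b * w y e)
        + ε * w y a * (christoffel G y e d b * nabla1 G w y c e) := fun e => by ring
  simp only [e, Finset.sum_add_distrib, ← Finset.mul_sum, ← Finset.sum_mul]
  ring

end NullField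

/-! ### Null frames -/

/-- Indices of a null frame: `none` stands for `l`, `some none` for `k`, `some (some i)` for
`m i`. -/
abbrev FrameIndex (n : ℕ) : Type := Option (Option (Fin (n - 2)))

namespace FrameIndex

variable {n : ℕ}

/-- The index of the frame vector that pairs to `1` with the given one. -/
def dual : FrameIndex n → FrameIndex n
  | none => some none
  | some none => none
  | some (some i) => some (some i)

/-- The boost weight. -/
def weight : FrameIndex n → ℤ
  | none => 1
  | some none => -1
  | some (some _) => 0

theorem dual_none : dual (none : FrameIndex n) = some none := rfl

theorem dual_some_none : dual (some none : FrameIndex n) = none := rfl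

theorem dual_some_some (i : Fin (n - 2)) : dual (some (some i)) = some (some i) := rfl

@[simp] theorem dual_dual (α : FrameIndex n) : dual (dual α) = α := by
  rcases α with _ | _ | i <;> rfl

@[simp] theorem weight_dual (α : FrameIndex n) : weight (dual α) = -weight α := by
  rcases α with _ | _ | i <;> rfl

theorem dual_eq_iff {α β : FrameIndex n} : dual α = β ↔ α = dual β :=
  ⟨fun h => by rw [← h, dual_dual], fun h => by rw [h, dual_dual]⟩

theorem card (hn : 2 ≤ n) : Fintype.card (FrameIndex n) = n := by
  simp only [Fintype.card_option, Fintype.card_fin]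
  omega

theorem sum_eq (f : FrameIndex n → ℝ) :
    ∑ α, f α = f none + f (some none) + ∑ i, f (some (some i)) := by
  rw [Fintype.sum_option, Fintype.sum_option, add_assoc]

end FrameIndex

open FrameIndex

section Frame

variable {n : ℕ}

/-- The vectors of the frame `l, k, m`, as a single family. -/
def frame (l k : Fin n → ℝ) (m : Fin (n - 2) → Fin n → ℝ) : FrameIndex n → Fin n → ℝ
  | none => l
  | some none => k
  | some (some i) => m i

/-- The frame component `T_{ab} u^a v^b`. -/
def comp2 (T : Fin n → Fin n → ℝ) (u v : Fin n → ℝ) : ℝ := ∑ a, ∑ b, T a b * u a * v b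

variable {g : Matrix (Fin n) (Fin n) ℝ} {l k : Fin n → ℝ} {m : Fin (n - 2) → Fin n → ℝ}

theorem comp2_swap (T : Fin n → Fin n → ℝ) (u v : Fin n → ℝ) :
    comp2 (fun a b => T b a) u v = comp2 T v u := by
  simp only [comp2]
  rw [Finset.sum_comm]
  exact Finset.sum_congr rfl fun _ _ => Finset.sum_congr rfl fun _ _ => by ring

theorem dot_comm (hg : ∀ a b, g a b = g b a) (u v : Fin n → ℝ) : dot g u v = dot g v u := by
  have h := comp2_swap (fun a b => g a b) u v
  simp only [comp2] at h
  simp only [dot]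
  rw [← h]
  exact Finset.sum_congr rfl fun a _ => Finset.sum_congr rfl fun b _ => by rw [hg]

/-- The components of the metric in a null frame. -/
def frameMetric (α β : FrameIndex n) : ℝ := if β = dual α then 1 else 0

theorem frameMetric_comm (α β : FrameIndex n) : frameMetric α β = frameMetric β α := by
  have h : β = dual α ↔ α = dual β := by rw [← dual_eq_iff, eq_comm]
  simp only [frameMetric, h]

theorem frameMetric_eq_zero {α β : FrameIndex n} (h : weight α + weight β ≠ 0) :
    frameMetric α β = 0 := by
  refine if_neg fun hβ => h ?_
  rw [hβ, weight_dual, add_neg_cancel]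

theorem frameMetric_none_mul_none {α β : FrameIndex n} (h : weight α + weight β ≠ -2) :
    frameMetric none α * frameMetric none β = 0 := by
  have h1 : weight (none : FrameIndex n) = 1 := rfl
  by_cases hα : weight α = -1
  · rw [frameMetric_eq_zero (β := β) (by omega), mul_zero]
  · rw [frameMetric_eq_zero (β := α) (by omega), zero_mul]

theorem dot_frame (hg : ∀ a b, g a b = g b a) (hF : IsNullFrame g l k m) (α β : FrameIndex n) :
    dot g (frame l k m α) (frame l k m β) = frameMetric α β := by
  have h1 := dot_comm hg
  rcases α with _ | _ | i <;> rcases β with _ | _ | j <;>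
    simp only [frameMetric, frame, dual, hF.l_null, hF.k_null, hF.k_l, hF.l_m, hF.k_m, hF.m_m, h1 l k,
      h1 (m _) l, h1 (m _) k, reduceCtorEq, if_true, if_false, Option.some.injEq, eq_comm]

/-- Completeness of a null frame: `g^{ab} = l^a k^b + k^a l^b + ∑ m_i^a m_i^b`. -/
theorem inv_eq_sum_frame (hn : 2 ≤ n) (hg : ∀ a b, g a b = g b a)
    (hF : IsNullFrame g l k m) (a b : Fin n) :
    g⁻¹ a b = ∑ α, frame l k m α a * frame l k m (dual α) b := by
  let A : Matrix (FrameIndex n) (Fin n) ℝ := Matrix.of fun α a => frame l k m α a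
  let D : Matrix (Fin n) (FrameIndex n) ℝ := Matrix.of fun a α => frame l k m (dual α) a
  have h1 : A * (g * D) = 1 := by
    ext α β
    have h := dot_frame hg hF α (dual β)
    rw [Matrix.one_apply]
    simp only [Matrix.mul_apply, A, D, Matrix.of_apply]
    have e : (dual β = dual α) ↔ α = β := by rw [dual_eq_iff, dual_dual, eq_comm]
    simp only [frameMetric, e] at h
    rw [← h]
    simp only [dot, Finset.mul_sum]
    exact Finset.sum_congr rfl fun _ _ => Finset.sum_congr rfl fun _ _ => by ring
  have h2 : (g * D) * A = 1 :=
    (Matrix.mul_eq_one_comm_of_card_eq _ _ _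
      (by rw [FrameIndex.card hn, Fintype.card_fin])).1 h1
  rw [Matrix.mul_assoc] at h2
  have h3 : g⁻¹ = D * A := Matrix.inv_eq_right_inv h2
  rw [h3, Matrix.mul_apply]
  simp only [A, D, Matrix.of_apply]
  refine Fintype.sum_equiv ⟨dual, dual, dual_dual, dual_dual⟩ _ _ fun α => ?_
  simp

theorem sum_comm_pairs {ι κ : Type*} [Fintype ι] [Fintype κ] (f : ι → ι → κ → κ → ℝ) :
    ∑ a, ∑ c, ∑ b, ∑ d, f a c b d = ∑ b, ∑ d, ∑ a, ∑ c, f a c b d := by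
  rw [Finset.sum_congr rfl fun a _ => Finset.sum_comm, Finset.sum_comm]
  refine Finset.sum_congr rfl fun b _ => ?_
  rw [Finset.sum_congr rfl fun a _ => Finset.sum_comm, Finset.sum_comm]

/-- If a bilinear form has the diagonal form `∑_j F_j ⊗ F'_j`, its value is computed from the
components of the arguments along `F` and `F'`. -/
theorem sum_pairing {I J : Type*} [Fintype I] [Fintype J] {H : I → I → ℝ} {F F' : J → I → ℝ}
    (hH : ∀ i i', H i i' = ∑ j, F j i * F' j i') (X Y : I → ℝ) :
    ∑ i, ∑ i', H i i' * X i * Y i' = ∑ j, (∑ i, X i * F j i) * (∑ i', Y i' * F' j i') := by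
  simp only [hH, Finset.sum_mul, Finset.mul_sum]
  rw [Finset.sum_congr rfl fun _ _ => Finset.sum_comm, Finset.sum_comm]
  refine Finset.sum_congr rfl fun j _ => ?_
  rw [Finset.sum_comm]
  exact Finset.sum_congr rfl fun _ _ => Finset.sum_congr rfl fun _ _ => by ring

/-- The scalar product of two covectors in a null frame. -/
theorem sum_inv_mul_mul (hn : 2 ≤ n) (hg : ∀ a b, g a b = g b a)
    (hF : IsNullFrame g l k m) (X Y : Fin n → ℝ) :
    ∑ a, ∑ b, g⁻¹ a b * X a * Y b =
      ∑ α, (∑ a, X a * frame l k m α a) * ∑ a, Y a * frame l k m (dual α) a :=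
  sum_pairing (inv_eq_sum_frame hn hg hF) X Y

/-- The trace of a bilinear form in a null frame. -/
theorem sum_inv_mul (hn : 2 ≤ n) (hg : ∀ a b, g a b = g b a)
    (hF : IsNullFrame g l k m) (T : Fin n → Fin n → ℝ) :
    ∑ a, ∑ b, g⁻¹ a b * T a b = ∑ α, comp2 T (frame l k m α) (frame l k m (dual α)) := by
  simp only [inv_eq_sum_frame hn hg hF, comp2, Finset.sum_mul]
  rw [Finset.sum_congr rfl fun _ _ => Finset.sum_comm, Finset.sum_comm]
  exact Finset.sum_congr rfl fun _ _ => Finset.sum_congr rfl fun _ _ =>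
    Finset.sum_congr rfl fun _ _ => by ring

/-- Expansion of a vector in a null frame. -/
theorem eq_sum_frame (hn : 2 ≤ n) (hg : ∀ a b, g a b = g b a) (hdet : IsUnit g.det)
    (hF : IsNullFrame g l k m) (v : Fin n → ℝ) (a : Fin n) :
    v a = ∑ α, dot g (frame l k m (dual α)) v * frame l k m α a := by
  have h1 : v = (g⁻¹ * g).mulVec v := by rw [Matrix.nonsing_inv_mul g hdet, Matrix.one_mulVec]
  conv_lhs => rw [h1, ← Matrix.mulVec_mulVec]
  simp only [Matrix.mulVec, dotProduct, inv_eq_sum_frame hn hg hF, dot, Finset.sum_mul]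
  rw [Finset.sum_comm]
  refine Finset.sum_congr rfl fun α _ => Finset.sum_congr rfl fun b _ => ?_
  simp only [Finset.mul_sum]
  exact Finset.sum_congr rfl fun c _ => by ring

/-- A bilinear form in terms of its components in a null frame. -/
theorem comp2_eq_sum_frame (hn : 2 ≤ n) (hg : ∀ a b, g a b = g b a) (hdet : IsUnit g.det)
    (hF : IsNullFrame g l k m) (T : Fin n → Fin n → ℝ) (u v : Fin n → ℝ) :
    comp2 T u v = ∑ α, ∑ β, dot g (frame l k m (dual α)) u * dot g (frame l k m (dual β)) v
      * comp2 T (frame l k m α) (frame l k m β) := by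
  have h1 : comp2 T u v = ∑ a, ∑ b, ∑ α, ∑ β, dot g (frame l k m (dual α)) u
      * dot g (frame l k m (dual β)) v * (T a b * frame l k m α a * frame l k m β b) := by
    refine Finset.sum_congr rfl fun a _ => Finset.sum_congr rfl fun b _ => ?_
    rw [eq_sum_frame hn hg hdet hF u a, eq_sum_frame hn hg hdet hF v b, mul_assoc,
      Finset.sum_mul_sum, Finset.mul_sum]
    refine Finset.sum_congr rfl fun α _ => ?_
    rw [Finset.mul_sum]
    exact Finset.sum_congr rfl fun β _ => by ring
  rw [h1, sum_comm_pairs]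
  simp only [comp2, Finset.mul_sum]

/-! ### Curvature-like tensors in a null frame -/

theorem comp4_add (S T : Fin n → Fin n → Fin n → Fin n → ℝ) (u v w z : Fin n → ℝ) :
    comp4 (fun a b c d => S a b c d + T a b c d) u v w z = comp4 S u v w z + comp4 T u v w z := by
  simp only [comp4, add_mul, Finset.sum_add_distrib]

theorem comp4_smul (r : ℝ) (T : Fin n → Fin n → Fin n → Fin n → ℝ) (u v w z : Fin n → ℝ) :
    comp4 (fun a b c d => r * T a b c d) u v w z = r * comp4 T u v w z := by
  simp only [comp4, Finset.mul_sum]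
  exact Finset.sum_congr rfl fun _ _ => Finset.sum_congr rfl fun _ _ =>
    Finset.sum_congr rfl fun _ _ => Finset.sum_congr rfl fun _ _ => by ring

theorem comp4_swap_left (T : Fin n → Fin n → Fin n → Fin n → ℝ) (u v w z : Fin n → ℝ) :
    comp4 (fun a b c d => T b a c d) u v w z = comp4 T v u w z := by
  simp only [comp4]
  rw [Finset.sum_comm]
  exact Finset.sum_congr rfl fun _ _ => Finset.sum_congr rfl fun _ _ =>
    Finset.sum_congr rfl fun _ _ => Finset.sum_congr rfl fun _ _ => by ring

theorem comp4_swap_right (T : Fin n → Fin n → Fin n → Fin n → ℝ) (u v w z : Fin n → ℝ) :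
    comp4 (fun a b c d => T a b d c) u v w z = comp4 T u v z w := by
  simp only [comp4]
  refine Finset.sum_congr rfl fun _ _ => Finset.sum_congr rfl fun _ _ => ?_
  rw [Finset.sum_comm]
  exact Finset.sum_congr rfl fun _ _ => Finset.sum_congr rfl fun _ _ => by ring

theorem comp4_swap_middle (T : Fin n → Fin n → Fin n → Fin n → ℝ) (u v w z : Fin n → ℝ) :
    comp4 (fun a b c d => T a c b d) u v w z = comp4 T u w v z := by
  simp only [comp4]
  refine Finset.sum_congr rfl fun _ _ => ?_
  rw [Finset.sum_comm]
  exact Finset.sum_congr rfl fun _ _ => Finset.sum_congr rfl fun _ _ =>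
    Finset.sum_congr rfl fun _ _ => by ring

theorem comp4_mul (A B : Fin n → Fin n → ℝ) (u v w z : Fin n → ℝ) :
    comp4 (fun a b c d => A a b * B c d) u v w z = comp2 A u v * comp2 B w z := by
  simp only [comp4, comp2, Finset.sum_mul]
  refine Finset.sum_congr rfl fun _ _ => Finset.sum_congr rfl fun _ _ => ?_
  simp only [Finset.mul_sum]
  exact Finset.sum_congr rfl fun _ _ => Finset.sum_congr rfl fun _ _ => by ring

/-- The symmetries of the Riemann tensor. -/
structure IsCurvatureLike {V : Type*} (z : V → V → V → V → ℝ) : Prop where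
  antisymm_left : ∀ a b c d, z a b c d = -z b a c d
  antisymm_right : ∀ a b c d, z a b c d = -z a b d c
  cyclic : ∀ a b c d, z a b c d + z a c d b + z a d b c = 0

theorem IsCurvatureLike.pair_symm {V : Type*} {z : V → V → V → V → ℝ} (hz : IsCurvatureLike z)
    (a b c d : V) : z a b c d = z c d a b := by
  linarith [hz.cyclic a b c d, hz.cyclic b c d a, hz.cyclic c d a b, hz.cyclic d a b c,
    hz.antisymm_left a b c d, hz.antisymm_left b c a d, hz.antisymm_left c d a b,
    hz.antisymm_left d a c b, hz.antisymm_right a b c d, hz.antisymm_right b c d a,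
    hz.antisymm_right c d a b, hz.antisymm_right d a b c, hz.antisymm_left a c d b,
    hz.antisymm_right a c d b, hz.antisymm_left b d a c, hz.antisymm_right b d a c,
    hz.antisymm_left a d b c, hz.antisymm_right a d b c, hz.antisymm_right c a b d,
    hz.antisymm_right d b c a, hz.antisymm_left c b d a, hz.antisymm_right d a c b,
    hz.antisymm_right c b d a, hz.antisymm_left d c a b, hz.antisymm_left b a c d]

theorem IsCurvatureLike.comp4 {R : Fin n → Fin n → Fin n → Fin n → ℝ} (hR : IsCurvatureLike R) :
    IsCurvatureLike (comp4 R) where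
  antisymm_left u v w z := by
    rw [← comp4_swap_left, ← neg_one_mul, ← comp4_smul]
    congr 1; funext a b c d
    rw [hR.antisymm_left]; ring
  antisymm_right u v w z := by
    rw [← comp4_swap_right, ← neg_one_mul, ← comp4_smul]
    congr 1; funext a b c d
    rw [hR.antisymm_right]; ring
  cyclic u v w z := by
    have h1 : QuadraticGravity.comp4 R u w z v =
        QuadraticGravity.comp4 (fun a b c d => R a c d b) u v w z := by
      rw [← comp4_swap_right R, ← comp4_swap_middle (fun a b c d => R a b d c)]
    have h2 : QuadraticGravity.comp4 R u z v w =
        QuadraticGravity.comp4 (fun a b c d => R a d b c) u v w z := by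
      rw [← comp4_swap_middle R, ← comp4_swap_right (fun a b c d => R a c b d)]
    rw [h1, h2, ← comp4_add, ← comp4_add]
    simp only [hR.cyclic, QuadraticGravity.comp4, zero_mul, Finset.sum_const_zero]

end Frame

/-! ### Boost weights of the Riemann tensor -/

section Weights

variable {n : ℕ}

/-- A curvature-like tensor `C` whose trace has no component of nonnegative boost weight, and with
`C_{0i0j} = C_{0ijk} = C_{ijkl} = C_{01ij} = 0`, has itself no component of nonnegative boost weight:
the remaining ones, `C_{010i}`, `C_{0101}` and `C_{0i1j}`, are determined by traces and cyclic
sums. -/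
theorem eq_zero_of_weight_nonneg {z : FrameIndex n → FrameIndex n → FrameIndex n → FrameIndex n → ℝ}
    (hz : IsCurvatureLike z)
    (h1 : ∀ i j, z none (some (some i)) none (some (some j)) = 0)
    (h2 : ∀ i j p, z none (some (some i)) (some (some j)) (some (some p)) = 0)
    (h3 : ∀ i j p q, z (some (some i)) (some (some j)) (some (some p)) (some (some q)) = 0)
    (h4 : ∀ i j, z none (some none) (some (some i)) (some (some j)) = 0)
    (htr : ∀ β γ, 0 ≤ weight β + weight γ → ∑ α, z α β (dual α) γ = 0)
    {α β γ δ : FrameIndex n} (hw : 0 ≤ weight α + weight β + weight γ + weight δ) :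
    z α β γ δ = 0 := by
  have hL := hz.antisymm_left
  have hR := hz.antisymm_right
  have hP := hz.pair_symm
  have L0 : ∀ a c d, z a a c d = 0 := fun a c d => by linarith [hL a a c d]
  have R0 : ∀ a c d, z a c d d = 0 := fun a c d => by linarith [hR a c d d]
  -- `C_{010i}`
  have k1 : ∀ i, z none (some none) none (some (some i)) = 0 := by
    intro i
    have h := htr none (some (some i)) (by simp [weight])
    rw [FrameIndex.sum_eq] at h
    simp only [dual, L0, hL (some (some _)) none (some (some _)), h2] at h
    simp only [neg_zero, Finset.sum_const_zero] at h
    linarith [hL none (some none) none (some (some i))]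
  -- `C_{0i1j}`
  have k2 : ∀ i j, z none (some (some i)) (some none) (some (some j)) = 0 := by
    intro i j
    have h := htr (some (some i)) (some (some j)) (by simp [weight])
    rw [FrameIndex.sum_eq] at h
    simp only [dual, h3, Finset.sum_const_zero] at h
    have h5 := hz.cyclic none (some none) (some (some i)) (some (some j))
    rw [h4] at h5
    linarith [hR none (some (some i)) (some none) (some (some j)),
      hP (some none) (some (some i)) none (some (some j))]
  -- `C_{0101}`
  have k3 : z none (some none) none (some none) = 0 := by
    have h := htr none (some none) (by simp [weight])
    rw [FrameIndex.sum_eq] at h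
    have h6 : ∀ i, z (some (some i)) none (some (some i)) (some none) = 0 := fun i => by
      rw [hL, hR, k2]; simp
    simp only [dual, L0, h6, Finset.sum_const_zero] at h
    linarith [hL none (some none) none (some none)]
  have sL1 : ∀ c d, z (some none) none c d = -z none (some none) c d := fun c d => hL _ _ _ _
  have sL2 : ∀ i c d, z (some (some i)) none c d = -z none (some (some i)) c d :=
    fun i c d => hL _ _ _ _
  have sR1 : ∀ a b, z a b (some none) none = -z a b none (some none) := fun a b => hR _ _ _ _
  have sR2 : ∀ i a b, z a b (some (some i)) none = -z a b none (some (some i)) :=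
    fun i a b => hR _ _ _ _
  have sL3 : ∀ i c d, z (some (some i)) (some none) c d = -z (some none) (some (some i)) c d :=
    fun i c d => hL _ _ _ _
  have sR3 : ∀ i a b, z a b (some (some i)) (some none) = -z a b (some none) (some (some i)) :=
    fun i a b => hR _ _ _ _
  have k1' : ∀ i, z none (some (some i)) none (some none) = 0 := fun i => by rw [hP, k1]
  have k2' : ∀ i j, z (some none) (some (some i)) none (some (some j)) = 0 := fun i j => by
    rw [hP, k2]
  have h2' : ∀ i j p, z (some (some i)) (some (some j)) none (some (some p)) = 0 := fun i j p => by
    rw [hP, h2]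
  have h4' : ∀ i j, z (some (some i)) (some (some j)) none (some none) = 0 := fun i j => by
    rw [hP, h4]
  -- The symmetries bring every index pattern of nonnegative weight into one of the forms above.
  rcases α with _ | _ | i <;> rcases β with _ | _ | j <;> rcases γ with _ | _ | p <;>
    rcases δ with _ | _ | q <;>
    first
    | (simp only [L0, R0, h1, h2, h3, h4, k1, k2, k3, sL1, sL2, sL3, sR1, sR2, sR3, k1', k2', h2',
        h4', neg_zero]; done)
    | (exfalso; simp [weight] at hw)

end Weights

section CurvatureFrame

variable {n : ℕ} {G : MetricField n} {U : Set (Coord n)} {y : Coord n}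
  {l k : Fin n → ℝ} {m : Fin (n - 2) → Fin n → ℝ}

theorem IsMetricOn.isCurvatureLike_riemann (hG : IsMetricOn G U) (hy : y ∈ U) :
    IsCurvatureLike (riemann G y) where
  antisymm_left a b c d := by
    have h := congrFun (congrFun (hG.lower_curv_antisymm hy c d) b) a
    simpa [Matrix.mul_apply, curv, riemann] using h
  antisymm_right a b c d := by
    have h : ∀ e, riemannUp G y e b c d = -riemannUp G y e b d c := fun e => by
      have := congrFun (congrFun (curv_antisymm (G := G) c d y) e) b
      simpa [curv] using this
    simp only [riemann, h, mul_neg, Finset.sum_neg_distrib]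
  cyclic a b c d := by
    simp only [riemann]
    rw [← Finset.sum_add_distrib, ← Finset.sum_add_distrib]
    refine Finset.sum_eq_zero fun e _ => ?_
    rw [← mul_add, ← mul_add]
    have hc := christoffel_comm hG.symm
    have h : riemannUp G y e b c d + riemannUp G y e c d b + riemannUp G y e d b c = 0 := by
      simp only [riemannUp, Finset.sum_sub_distrib]
      simp only [hc _ _ d b, hc _ _ d c, hc _ _ c b]
      ring
    rw [h, mul_zero]

theorem IsMetricOn.sum_ginv_riemann (hG : IsMetricOn G U) (hy : y ∈ U) (b d : Fin n) :
    ∑ a, ∑ c, ginv G y a c * riemann G y a b c d = ricci G y b d := by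
  rw [Finset.sum_comm, ricci]
  refine Finset.sum_congr rfl fun c _ => ?_
  simp only [riemann, Finset.mul_sum]
  rw [Finset.sum_comm]
  have h : ∀ e, ∑ a, ginv G y a c * (G y a e * riemannUp G y e b c d)
      = (if c = e then 1 else 0) * riemannUp G y e b c d := by
    intro e
    rw [← hG.sum_ginv_mul hy c e, Finset.sum_mul]
    exact Finset.sum_congr rfl fun a _ => by rw [hG.ginv_comm y a c]; ring
  simp only [h]
  simp

theorem comp4_ac_db (A B : Fin n → Fin n → ℝ) (u v w z : Fin n → ℝ) :
    comp4 (fun a b c d => A a c * B d b) u v w z = comp2 A u w * comp2 B z v := by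
  rw [comp4_swap_middle (fun a b c d => A a b * B d c), comp4_mul A (fun c d => B d c), comp2_swap B]

theorem comp4_ad_cb (A B : Fin n → Fin n → ℝ) (u v w z : Fin n → ℝ) :
    comp4 (fun a b c d => A a d * B c b) u v w z = comp2 A u z * comp2 B w v := by
  rw [comp4_swap_right (fun a b c d => A a c * B d b), comp4_ac_db]

theorem comp4_bc_da (A B : Fin n → Fin n → ℝ) (u v w z : Fin n → ℝ) :
    comp4 (fun a b c d => A b c * B d a) u v w z = comp2 A v w * comp2 B z u := by
  rw [comp4_swap_left (fun a b c d => A a c * B d b), comp4_ac_db]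

theorem comp4_bd_ca (A B : Fin n → Fin n → ℝ) (u v w z : Fin n → ℝ) :
    comp4 (fun a b c d => A b d * B c a) u v w z = comp2 A v z * comp2 B w u := by
  rw [comp4_swap_left (fun a b c d => A a d * B c b), comp4_ad_cb]

/-- The components of the Weyl tensor. -/
theorem comp4_weyl (u v w z : Fin n → ℝ) :
    comp4 (weyl G y) u v w z = comp4 (riemann G y) u v w z
      - (1 / ((n : ℝ) - 2)) *
        (dot (G y) u w * comp2 (ricci G y) z v - dot (G y) u z * comp2 (ricci G y) w v
          - dot (G y) v w * comp2 (ricci G y) z u + dot (G y) v z * comp2 (ricci G y) w u)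
      + (1 / (((n : ℝ) - 1) * ((n : ℝ) - 2))) * scalarCurv G y *
        (dot (G y) u w * dot (G y) z v - dot (G y) u z * dot (G y) w v) := by
  have hd : ∀ u v, dot (G y) u v = comp2 (fun a b => G y a b) u v := fun _ _ => rfl
  simp only [hd]
  rw [← comp4_ac_db _ (ricci G y) u v w z, ← comp4_ad_cb _ (ricci G y) u v w z,
    ← comp4_bc_da _ (ricci G y) u v w z, ← comp4_bd_ca _ (ricci G y) u v w z,
    ← comp4_ac_db _ _ u v w z, ← comp4_ad_cb _ _ u v w z]
  simp only [comp4, weyl, Finset.mul_sum, ← Finset.sum_sub_distrib, ← Finset.sum_add_distrib]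
  exact Finset.sum_congr rfl fun _ _ => Finset.sum_congr rfl fun _ _ =>
    Finset.sum_congr rfl fun _ _ => Finset.sum_congr rfl fun _ _ => by ring

/-- `R_{ab} = r g_{ab} + Φ l_a l_b` at the point `y`. -/
def IsRadiationAt (G : MetricField n) (l : Fin n → ℝ) (r Φ : ℝ) (y : Coord n) : Prop :=
  ∀ a b, ricci G y a b = r * G y a b + Φ * ((∑ c, G y a c * l c) * ∑ c, G y b c * l c)

theorem IsMetricOn.sum_lower_mul (hG : IsMetricOn G U) (l u : Fin n → ℝ) :
    ∑ a, (∑ c, G y a c * l c) * u a = dot (G y) l u := by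
  rw [dot_comm (hG.symm y), dot]
  simp only [Finset.sum_mul]
  exact Finset.sum_congr rfl fun _ _ => Finset.sum_congr rfl fun _ _ => by ring

theorem IsMetricOn.comp2_ricci (hG : IsMetricOn G U) {r Φ : ℝ}
    (hr : IsRadiationAt G l r Φ y) (u v : Fin n → ℝ) :
    comp2 (ricci G y) u v = r * dot (G y) u v + Φ * (dot (G y) l u * dot (G y) l v) := by
  rw [← hG.sum_lower_mul l u, ← hG.sum_lower_mul l v, Finset.sum_mul_sum]
  simp only [comp2, dot, hr _ _, Finset.mul_sum (Finset.univ : Finset (Fin n)) _ r,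
    Finset.mul_sum (Finset.univ : Finset (Fin n)) _ Φ, ← Finset.sum_add_distrib]
  exact Finset.sum_congr rfl fun _ _ => Finset.sum_congr rfl fun _ _ => by ring

theorem IsMetricOn.comp2_ricci_frame (hG : IsMetricOn G U) {r Φ : ℝ}
    (hr : IsRadiationAt G l r Φ y) (hF : IsNullFrame (G y) l k m) (α β : FrameIndex n) :
    comp2 (ricci G y) (frame l k m α) (frame l k m β) =
      r * frameMetric α β + Φ * (frameMetric none α * frameMetric none β) := by
  have h : ∀ α, dot (G y) l (frame l k m α) = frameMetric none α := fun α =>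
    dot_frame (hG.symm y) hF none α
  rw [hG.comp2_ricci hr, dot_frame (hG.symm y) hF, h, h]

theorem IsMetricOn.scalarCurv_radiation (hG : IsMetricOn G U) (hn : 2 ≤ n)
    (hF : IsNullFrame (G y) l k m) {r Φ : ℝ} (hr : IsRadiationAt G l r Φ y) :
    scalarCurv G y = n * r := by
  have h := sum_inv_mul hn (hG.symm y) hF (ricci G y)
  rw [scalarCurv]
  simp only [ginv]
  rw [h]
  have e : ∀ α, comp2 (ricci G y) (frame l k m α) (frame l k m (dual α)) = r := by
    intro α
    rw [hG.comp2_ricci_frame hr hF, frameMetric_none_mul_none (by rw [weight_dual]; omega)]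
    simp [frameMetric]
  simp only [e, Finset.sum_const, Finset.card_univ, FrameIndex.card hn, nsmul_eq_mul]

/-- If the Weyl tensor has only components of negative boost weight and the Ricci tensor is that of
aligned null radiation, then the components of nonnegative boost weight of the Riemann tensor are
those of a space of constant curvature. -/
theorem IsMetricOn.comp4_riemann_frame (hG : IsMetricOn G U) (hy : y ∈ U) (hn : 4 ≤ n)
    (hF : IsNullFrame (G y) l k m) {r Φ : ℝ} (hr : IsRadiationAt G l r Φ y)
    (hW : OnlyNegativeBoostWeight (weyl G y) l k m) {α β γ δ : FrameIndex n}
    (hw : 0 ≤ weight α + weight β + weight γ + weight δ) :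
    comp4 (riemann G y) (frame l k m α) (frame l k m β) (frame l k m γ) (frame l k m δ) =
      r / ((n : ℝ) - 1) *
        (frameMetric α γ * frameMetric β δ - frameMetric α δ * frameMetric β γ) := by
  have hn4 : (4 : ℝ) ≤ n := by exact_mod_cast hn
  have hn1 : (n : ℝ) - 1 ≠ 0 := by linarith
  have hn2 : (n : ℝ) - 2 ≠ 0 := by linarith
  have hR := (hG.isCurvatureLike_riemann hy).comp4
  set F := frame l k m
  let z : FrameIndex n → FrameIndex n → FrameIndex n → FrameIndex n → ℝ := fun α β γ δ =>
    comp4 (riemann G y) (F α) (F β) (F γ) (F δ) - r / ((n : ℝ) - 1) *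
        (frameMetric α γ * frameMetric β δ - frameMetric α δ * frameMetric β γ)
  have hcomm : ∀ α β : FrameIndex n, frameMetric α β = frameMetric β α := frameMetric_comm
  have hz : IsCurvatureLike z :=
    ⟨fun a b c d => by simp only [z]; rw [hR.antisymm_left]; ring,
      fun a b c d => by simp only [z]; rw [hR.antisymm_right]; ring,
      fun a b c d => by
        simp only [z]
        rw [hcomm b c, hcomm d b, hcomm d c]
        linear_combination hR.cyclic (F a) (F b) (F c) (F d)⟩
  -- Down to boost weight `-1`, the components of `z` are those of the Weyl tensor.
  have hzW : ∀ α β γ δ : FrameIndex n, -1 ≤ weight α + weight β + weight γ + weight δ →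
      z α β γ δ = comp4 (weyl G y) (F α) (F β) (F γ) (F δ) := by
    intro α β γ δ h
    have key : ∀ α β γ δ : FrameIndex n, -1 ≤ weight α + weight β + weight γ + weight δ →
        frameMetric α β * (frameMetric none γ * frameMetric none δ) = 0 := by
      intro α β γ δ h
      by_cases h2 : weight α + weight β = 0
      · rw [frameMetric_none_mul_none (by omega), mul_zero]
      · rw [frameMetric_eq_zero h2, zero_mul]
    rw [comp4_weyl, hG.scalarCurv_radiation (by omega) hF hr]
    simp only [F, hG.comp2_ricci_frame hr hF, dot_frame (hG.symm y) hF, z]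
    have k1 := key α γ δ β (by omega)
    have k2 := key α δ γ β (by omega)
    have k3 := key β γ δ α (by omega)
    have k4 := key β δ γ α (by omega)
    rw [hcomm δ β, hcomm γ β, hcomm δ α, hcomm γ α]
    field_simp
    linear_combination ((n : ℝ) - 1) * Φ * (k1 - k2 - k3 + k4)
  have h0 := eq_zero_of_weight_nonneg hz
    (fun i j => by rw [hzW _ _ _ _ (by simp [weight])]; exact hW.c0i0j i j)
    (fun i j p => by rw [hzW _ _ _ _ (by simp [weight])]; exact hW.c0ijk i j p)
    (fun i j p q => by rw [hzW _ _ _ _ (by simp [weight])]; exact hW.cijkl i j p q)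
    (fun i j => by rw [hzW _ _ _ _ (by simp [weight])]; exact hW.c01ij i j)
    (fun β γ hβγ => by
      have h1 : ∑ α, comp4 (riemann G y) (F α) (F β) (F (dual α)) (F γ)
          = comp2 (ricci G y) (F β) (F γ) := by
        have e1 : ∀ α, comp4 (riemann G y) (F α) (F β) (F (dual α)) (F γ) =
            comp2 (fun a c => ∑ b, ∑ d, riemann G y a b c d * F β b * F γ d)
              (F α) (F (dual α)) := by
          intro α
          simp only [comp4, comp2, Finset.sum_mul]
          refine Finset.sum_congr rfl fun _ _ => ?_
          rw [Finset.sum_comm]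
          exact Finset.sum_congr rfl fun _ _ => Finset.sum_congr rfl fun _ _ =>
            Finset.sum_congr rfl fun _ _ => by ring
        simp only [e1]
        rw [← sum_inv_mul (by omega) (hG.symm y) hF]
        simp only [comp2, ← hG.sum_ginv_riemann hy, ginv, Finset.mul_sum, Finset.sum_mul]
        rw [sum_comm_pairs]
        exact Finset.sum_congr rfl fun _ _ => Finset.sum_congr rfl fun _ _ =>
          Finset.sum_congr rfl fun _ _ => Finset.sum_congr rfl fun _ _ => by ring
      simp only [z, Finset.sum_sub_distrib, h1, ← Finset.mul_sum]
      rw [hG.comp2_ricci_frame hr hF, frameMetric_none_mul_none (by omega)]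
      have h2 : ∑ α : FrameIndex n, frameMetric α (dual α) * frameMetric β γ
          = n * frameMetric β γ := by
        simp [frameMetric, FrameIndex.card (n := n) (by omega)]
      have h3 : ∑ α : FrameIndex n, frameMetric α γ * frameMetric β (dual α)
          = frameMetric β γ := by
        rw [Finset.sum_eq_single (dual γ)]
        · rw [dual_dual]; simp [frameMetric]
        · intro α _ hα
          rw [frameMetric, if_neg (fun h => hα (by rw [h, dual_dual])), zero_mul]
        · simp
      rw [h2, h3]
      field_simp
      ring) hw
  exact sub_eq_zero.1 h0

end CurvatureFrame

/-! ### Quadratic curvature terms of boost weight zero -/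

section FieldEquations

variable {n : ℕ} {G : MetricField n} {U : Set (Coord n)} {y : Coord n}
  {l k : Fin n → ℝ} {m : Fin (n - 2) → Fin n → ℝ} {r Φ : ℝ}

theorem IsMetricOn.ricciUp_radiation (hG : IsMetricOn G U) (hy : y ∈ U)
    (hr : IsRadiationAt G l r Φ y) (a b : Fin n) :
    ricciUp G y a b = r * ginv G y a b + Φ * (l a * l b) := by
  have h1 : ∀ a, ∑ c, ginv G y a c * (∑ e, G y c e * l e) = l a := by
    intro a
    simp only [Finset.mul_sum, ← mul_assoc]
    rw [Finset.sum_comm]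
    simp only [← Finset.sum_mul, hG.sum_ginv_mul hy]
    simp
  have h2 : ∑ c, ∑ d, ginv G y a c * ginv G y b d * G y c d = ginv G y a b := by
    rw [Finset.sum_comm]
    have : ∀ d, ∑ c, ginv G y a c * ginv G y b d * G y c d
        = (if a = d then 1 else 0) * ginv G y b d := by
      intro d
      rw [← hG.sum_ginv_mul hy a d, Finset.sum_mul]
      exact Finset.sum_congr rfl fun c _ => by ring
    simp only [this]
    simp [hG.ginv_comm y b a]
  rw [ricciUp, ← h2]
  conv_rhs => rw [← h1 a, ← h1 b]
  rw [Finset.sum_mul_sum, Finset.mul_sum, Finset.mul_sum, ← Finset.sum_add_distrib]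
  refine Finset.sum_congr rfl fun c _ => ?_
  rw [Finset.mul_sum, Finset.mul_sum, ← Finset.sum_add_distrib]
  refine Finset.sum_congr rfl fun d _ => ?_
  rw [hr c d]; ring

theorem IsMetricOn.comp2_riemannRicci_frame (hG : IsMetricOn G U) (hy : y ∈ U) (hn : 4 ≤ n)
    (hF : IsNullFrame (G y) l k m) (hr : IsRadiationAt G l r Φ y)
    (hW : OnlyNegativeBoostWeight (weyl G y) l k m) {α β : FrameIndex n}
    (hw : weight α + weight β = 0) :
    comp2 (riemannRicci G y) (frame l k m α) (frame l k m β) = r ^ 2 * frameMetric α β := by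
  have hR := hG.isCurvatureLike_riemann hy
  have h1 : ∀ a b, riemannRicci G y a b =
      r * ricci G y a b + Φ * ∑ c, ∑ d, riemann G y a c b d * (l c * l d) := by
    intro a b
    have hs : ∀ c d, riemann G y a c b d = riemann G y c a d b := fun c d => by
      rw [hR.antisymm_left, hR.antisymm_right, neg_neg]
    rw [← hG.sum_ginv_riemann hy a b, riemannRicci]
    simp only [hG.ricciUp_radiation hy hr, hs, Finset.mul_sum, ← Finset.sum_add_distrib]
    exact Finset.sum_congr rfl fun _ _ => Finset.sum_congr rfl fun _ _ => by ring
  have h2 : comp2 (riemannRicci G y) (frame l k m α) (frame l k m β) =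
      r * comp2 (ricci G y) (frame l k m α) (frame l k m β)
        + Φ * comp4 (riemann G y) (frame l k m α) l (frame l k m β) l := by
    simp only [comp2, h1, comp4, Finset.mul_sum, Finset.sum_mul, add_mul, Finset.sum_add_distrib]
    congr 1
    · exact Finset.sum_congr rfl fun _ _ => Finset.sum_congr rfl fun _ _ => by ring
    · refine Finset.sum_congr rfl fun _ _ => ?_
      rw [Finset.sum_comm]
      exact Finset.sum_congr rfl fun _ _ => Finset.sum_congr rfl fun _ _ =>
        Finset.sum_congr rfl fun _ _ => by ring
  have h3 := hG.comp4_riemann_frame hy hn hF hr hW (α := α) (β := none) (γ := β) (δ := none)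
    (by rw [show weight (none : FrameIndex n) = 1 from rfl]; omega)
  have h4 : frameMetric (none : FrameIndex n) none = 0 := frameMetric_eq_zero (by simp [weight])
  rw [h4, frameMetric_comm α none, frameMetric_none_mul_none (by omega)] at h3
  rw [h2, hG.comp2_ricci_frame hr hF, frameMetric_none_mul_none (by omega)]
  change comp4 (riemann G y) (frame l k m α) l (frame l k m β) l = _ at h3
  rw [h3]; ring

theorem IsMetricOn.comp2_ricciRicci_frame (hG : IsMetricOn G U) (hn : 4 ≤ n)
    (hF : IsNullFrame (G y) l k m) (hr : IsRadiationAt G l r Φ y) {α β : FrameIndex n}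
    (hw : weight α + weight β = 0) :
    comp2 (ricciRicci G y) (frame l k m α) (frame l k m β) = r ^ 2 * frameMetric α β := by
  have h1 : comp2 (ricciRicci G y) (frame l k m α) (frame l k m β) =
      ∑ γ, comp2 (ricci G y) (frame l k m α) (frame l k m γ)
        * comp2 (ricci G y) (frame l k m β) (frame l k m (dual γ)) := by
    have e : ∀ β γ, comp2 (ricci G y) (frame l k m β) (frame l k m γ)
        = ∑ c, (∑ a, ricci G y a c * frame l k m β a) * frame l k m γ c := by
      intro β γ
      simp only [comp2, Finset.sum_mul]
      rw [Finset.sum_comm]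
    simp only [e]
    rw [← sum_inv_mul_mul (by omega) (hG.symm y) hF]
    simp only [comp2, ricciRicci, ginv, Finset.sum_mul, Finset.mul_sum]
    rw [sum_comm_pairs]
    refine Finset.sum_congr rfl fun _ _ => Finset.sum_congr rfl fun _ _ => ?_
    rw [Finset.sum_comm]
    exact Finset.sum_congr rfl fun _ _ => Finset.sum_congr rfl fun _ _ => by ring
  have h2 : ∀ γ, comp2 (ricci G y) (frame l k m α) (frame l k m γ)
        * comp2 (ricci G y) (frame l k m β) (frame l k m (dual γ))
      = r ^ 2 * (frameMetric α γ * frameMetric β (dual γ)) := by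
    intro γ
    simp only [hG.comp2_ricci_frame hr hF]
    have hd := weight_dual γ
    rcases lt_trichotomy (weight α + weight γ) 0 with h | h | h
    · rw [frameMetric_eq_zero (α := β) (β := dual γ) (by omega),
        frameMetric_none_mul_none (α := β) (by omega)]
      ring
    · rw [frameMetric_none_mul_none (α := β) (by omega),
        frameMetric_none_mul_none (α := α) (by omega)]
      ring
    · rw [frameMetric_eq_zero (α := α) (β := γ) (by omega),
        frameMetric_none_mul_none (α := α) (by omega)]
      ring
  rw [h1]
  simp only [h2, ← Finset.mul_sum]
  congr 1
  rw [Finset.sum_eq_single (dual α)]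
  · rw [dual_dual, frameMetric_comm β α]; simp [frameMetric]
  · intro γ _ hγ
    rw [frameMetric, if_neg hγ, zero_mul]
  · simp

theorem IsMetricOn.comp2_riemannRiemann (hG : IsMetricOn G U) (hn : 2 ≤ n)
    (hF : IsNullFrame (G y) l k m) (u v : Fin n → ℝ) :
    comp2 (riemannRiemann G y) u v = ∑ J : FrameIndex n × FrameIndex n × FrameIndex n,
      comp4 (riemann G y) u (frame l k m J.1) (frame l k m J.2.1) (frame l k m J.2.2)
        * comp4 (riemann G y) v (frame l k m (dual J.1)) (frame l k m (dual J.2.1))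
          (frame l k m (dual J.2.2)) := by
  let H : Fin n × Fin n × Fin n → Fin n × Fin n × Fin n → ℝ := fun i i' =>
    ginv G y i.1 i'.1 * ginv G y i.2.1 i'.2.1 * ginv G y i.2.2 i'.2.2
  let F : FrameIndex n × FrameIndex n × FrameIndex n → Fin n × Fin n × Fin n → ℝ := fun J i =>
    frame l k m J.1 i.1 * frame l k m J.2.1 i.2.1 * frame l k m J.2.2 i.2.2
  let F' : FrameIndex n × FrameIndex n × FrameIndex n → Fin n × Fin n × Fin n → ℝ := fun J =>
    F (dual J.1, dual J.2.1, dual J.2.2)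
  have hH : ∀ i i', H i i' = ∑ J, F J i * F' J i' := by
    intro i i'
    simp only [H, F, F', ginv, inv_eq_sum_frame hn (hG.symm y) hF, Fintype.sum_prod_type]
    rw [Finset.sum_mul_sum, Finset.sum_mul]
    refine Finset.sum_congr rfl fun _ _ => ?_
    rw [Finset.sum_mul]
    refine Finset.sum_congr rfl fun _ _ => ?_
    rw [Finset.mul_sum]
    exact Finset.sum_congr rfl fun _ _ => by ring
  have hX : ∀ (u : Fin n → ℝ) J, comp4 (riemann G y) u (frame l k m J.1) (frame l k m J.2.1)
      (frame l k m J.2.2) = ∑ i : Fin n × Fin n × Fin n,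
        (∑ a, riemann G y a i.1 i.2.1 i.2.2 * u a) * F J i := by
    intro u J
    simp only [Finset.sum_mul]
    rw [Finset.sum_comm]
    simp only [comp4, F, Fintype.sum_prod_type]
    exact Finset.sum_congr rfl fun _ _ => Finset.sum_congr rfl fun _ _ =>
      Finset.sum_congr rfl fun _ _ => Finset.sum_congr rfl fun _ _ => by ring
  have hX' := fun (v : Fin n → ℝ) (J : FrameIndex n × FrameIndex n × FrameIndex n) =>
    hX v (dual J.1, dual J.2.1, dual J.2.2)
  simp only at hX'
  simp only [hX, hX']
  rw [← sum_pairing hH]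
  have hRR : ∀ a b, riemannRiemann G y a b = ∑ i, ∑ i', H i i' *
      riemann G y a i.1 i.2.1 i.2.2 * riemann G y b i'.1 i'.2.1 i'.2.2 := by
    intro a b
    simp only [riemannRiemann, H, Fintype.sum_prod_type]
  simp only [comp2, hRR, Finset.sum_mul, Finset.mul_sum]
  rw [sum_comm_pairs]
  refine Finset.sum_congr rfl fun _ _ => Finset.sum_congr rfl fun _ _ => ?_
  rw [Finset.sum_comm]
  exact Finset.sum_congr rfl fun _ _ => Finset.sum_congr rfl fun _ _ => by ring

theorem sum_frameMetric_sq (hn : 2 ≤ n) (α β : FrameIndex n) :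
    ∑ J : FrameIndex n × FrameIndex n × FrameIndex n,
      (frameMetric α J.2.1 * frameMetric J.1 J.2.2 - frameMetric α J.2.2 * frameMetric J.1 J.2.1)
      * (frameMetric β (dual J.2.1) * frameMetric (dual J.1) (dual J.2.2)
        - frameMetric β (dual J.2.2) * frameMetric (dual J.1) (dual J.2.1))
    = 2 * ((n : ℝ) - 1) * frameMetric α β := by
  have h1 : ∀ γ δ : FrameIndex n, frameMetric (dual γ) (dual δ) = frameMetric γ δ := by
    intro γ δ
    simp only [frameMetric, dual_dual, dual_eq_iff]
  have h2 : ∀ γ : FrameIndex n, frameMetric β (dual γ) = if γ = β then 1 else 0 := by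
    intro γ
    simp only [frameMetric, dual_eq_iff, dual_dual]
  simp only [Fintype.sum_prod_type, h1, h2]
  simp only [frameMetric]
  have e : ∀ β' γ δ : FrameIndex n,
      ((if γ = dual α then (1 : ℝ) else 0) * (if δ = dual β' then 1 else 0)
        - (if δ = dual α then 1 else 0) * (if γ = dual β' then 1 else 0))
      * ((if γ = β then 1 else 0) * (if δ = dual β' then 1 else 0)
        - (if δ = β then 1 else 0) * (if γ = dual β' then 1 else 0))
      = (if δ = dual β' then (if γ = dual α then (if γ = β then (1 : ℝ) else 0) else 0) else 0)
      - (if δ = β then (if γ = dual α then (if γ = dual β' then (if δ = dual β' then (1 : ℝ)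
          else 0) else 0) else 0) else 0)
      - (if δ = dual α then (if γ = β then (if γ = dual β' then (if δ = dual β' then (1 : ℝ)
          else 0) else 0) else 0) else 0)
      + (if δ = dual α then (if δ = β then (if γ = dual β' then (1 : ℝ) else 0) else 0) else 0) := by
    intro β' γ δ
    split_ifs <;> norm_num
  simp only [e]
  simp only [Finset.sum_add_distrib, Finset.sum_sub_distrib, Finset.sum_ite_eq', Finset.mem_univ,
    if_true]
  have h3 : ∀ x : FrameIndex n, dual α = dual x ↔ x = α := fun x => by
    rw [dual_eq_iff, dual_dual, eq_comm]
  by_cases h : β = dual α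
  · subst h
    simp only [h3, if_true, Finset.sum_ite_eq', Finset.mem_univ, Finset.sum_const,
      Finset.card_univ, FrameIndex.card hn, nsmul_eq_mul]
    ring
  · have h4 : ∀ x, ¬ (dual α = dual x ∧ β = dual x) := fun x hx => h (hx.2.trans hx.1.symm)
    have h5 : ∀ x, ¬ (β = dual x ∧ dual α = dual x) := fun x hx => h (hx.1.trans hx.2.symm)
    simp only [← ite_and, h4, h5, if_neg h, if_neg (Ne.symm h), if_false, Finset.sum_const_zero]
    ring

theorem IsMetricOn.comp2_riemannRiemann_frame (hG : IsMetricOn G U) (hy : y ∈ U) (hn : 4 ≤ n)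
    (hF : IsNullFrame (G y) l k m) (hr : IsRadiationAt G l r Φ y)
    (hW : OnlyNegativeBoostWeight (weyl G y) l k m) {α β : FrameIndex n}
    (hw : weight α + weight β = 0) :
    comp2 (riemannRiemann G y) (frame l k m α) (frame l k m β) =
      (r / ((n : ℝ) - 1)) ^ 2 * (2 * ((n : ℝ) - 1)) * frameMetric α β := by
  have h0 : ∀ α β γ δ : FrameIndex n, weight α + weight β + weight γ + weight δ ≠ 0 →
      frameMetric α γ * frameMetric β δ - frameMetric α δ * frameMetric β γ = 0 := by
    have key : ∀ α β γ δ : FrameIndex n, weight α + weight β + weight γ + weight δ ≠ 0 →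
        frameMetric α β * frameMetric γ δ = 0 := by
      intro α β γ δ h
      by_cases h1 : weight α + weight β = 0
      · rw [frameMetric_eq_zero (α := γ) (by omega), mul_zero]
      · rw [frameMetric_eq_zero h1, zero_mul]
    intro α β γ δ h
    rw [key _ _ _ _ (by omega), key _ _ _ _ (by omega), sub_zero]
  rw [hG.comp2_riemannRiemann (by omega) hF, mul_assoc, ← sum_frameMetric_sq (by omega),
    Finset.mul_sum]
  refine Finset.sum_congr rfl fun J _ => ?_
  obtain ⟨γ, δ, ε⟩ := J
  have hd1 := weight_dual γ
  have hd2 := weight_dual δ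
  have hd3 := weight_dual ε
  simp only
  -- The two factors have opposite boost weights.
  rcases lt_trichotomy (weight α + weight γ + weight δ + weight ε) 0 with h | h | h
  · rw [hG.comp4_riemann_frame hy hn hF hr hW (α := β) (by omega),
      h0 β (dual γ) (dual δ) (dual ε) (by omega)]
    ring
  · rw [hG.comp4_riemann_frame hy hn hF hr hW (α := β) (by omega),
      hG.comp4_riemann_frame hy hn hF hr hW (α := α) (by omega)]
    ring
  · rw [hG.comp4_riemann_frame hy hn hF hr hW (α := α) (by omega),
      h0 α γ δ ε (by omega)]
    ring

end FieldEquations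

/-! ### The field equations in a null frame -/

section Kundt

variable {n : ℕ} {G : MetricField n} {U : Set (Coord n)} {y : Coord n}
  {l k : Fin n → ℝ} {m : Fin (n - 2) → Fin n → ℝ} {r Φ : ℝ}

theorem comp2_fieldEqLhs (α β γ κ Λ₀ : ℝ) (u v : Fin n → ℝ) :
    comp2 (fieldEqLhs G α β γ κ Λ₀ y) u v =
      (1 / κ) * (comp2 (ricci G y) u v - (1 / 2) * scalarCurv G y * dot (G y) u v
        + Λ₀ * dot (G y) u v)
      + 2 * α * scalarCurv G y * (comp2 (ricci G y) u v
        - (1 / 4) * scalarCurv G y * dot (G y) u v)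
      + (2 * α + β) * (dot (G y) u v * box0 G (scalarCurv G) y
        - comp2 (hess G (scalarCurv G) y) u v)
      + 2 * γ * (scalarCurv G y * comp2 (ricci G y) u v - 2 * comp2 (riemannRicci G y) u v
        + comp2 (riemannRiemann G y) u v - 2 * comp2 (ricciRicci G y) u v
        - (1 / 4) * dot (G y) u v * (riemannSq G y - 4 * ricciSq G y + scalarCurv G y ^ 2))
      + β * comp2 (box2 G
          (fun z c d => ricci G z c d - (1 / 2) * scalarCurv G z * G z c d) y) u v
      + 2 * β * (comp2 (riemannRicci G y) u v - (1 / 4) * dot (G y) u v * ricciSq G y) := by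
  simp only [comp2, dot, fieldEqLhs, Finset.mul_sum, Finset.sum_mul, ← Finset.sum_sub_distrib,
    ← Finset.sum_add_distrib]
  exact Finset.sum_congr rfl fun _ _ => Finset.sum_congr rfl fun _ _ => by ring

/-- For aligned null radiation with a Weyl tensor of negative boost weight, the components of boost
weight `0` of all algebraic terms of the field equations are pure trace. -/
theorem IsMetricOn.comp2_fieldEqLhs_frame (hG : IsMetricOn G U) (hy : y ∈ U) (hn : 4 ≤ n)
    (hS : ∀ z ∈ U, scalarCurv G z = n * r) (hF : IsNullFrame (G y) l k m)
    (hr : IsRadiationAt G l r Φ y) (hW : OnlyNegativeBoostWeight (weyl G y) l k m)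
    (α β γ κ Λ₀ : ℝ) :
    ∃ A : ℝ, ∀ i j : FrameIndex n, weight i + weight j = 0 →
      comp2 (fieldEqLhs G α β γ κ Λ₀ y) (frame l k m i) (frame l k m j) = A * frameMetric i j
        + β * comp2 (box2 G (fun z c d => ricci G z c d - (1 / 2) * scalarCurv G z * G z c d) y)
          (frame l k m i) (frame l k m j) := by
  have hpd : ∀ z ∈ U, ∀ a, pd (scalarCurv G) a z = 0 := fun z hz a => by
    rw [pd_congr_on (h := fun _ => n * r) hG.isOpen hz hS, pd_const]
  have hhess : ∀ a b, hess G (scalarCurv G) y a b = 0 := by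
    intro a b
    simp only [hess, nabla1, hpd y hy, mul_zero, Finset.sum_const_zero, sub_zero]
    rw [pd_congr_on (h := fun _ => 0) hG.isOpen hy (fun z hz => hpd z hz b), pd_const]
  have hbox : box0 G (scalarCurv G) y = 0 := by
    simp only [box0, hhess, mul_zero, Finset.sum_const_zero]
  have hhess2 : ∀ u v, comp2 (hess G (scalarCurv G) y) u v = 0 := fun u v => by
    simp only [comp2, hhess, zero_mul, Finset.sum_const_zero]
  refine ⟨(1 / κ) * (r - (1 / 2) * scalarCurv G y + Λ₀)
    + 2 * α * scalarCurv G y * (r - (1 / 4) * scalarCurv G y)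
    + 2 * γ * (scalarCurv G y * r - 2 * r ^ 2
      + (r / ((n : ℝ) - 1)) ^ 2 * (2 * ((n : ℝ) - 1)) - 2 * r ^ 2
      - (1 / 4) * (riemannSq G y - 4 * ricciSq G y + scalarCurv G y ^ 2))
    + 2 * β * (r ^ 2 - (1 / 4) * ricciSq G y), fun i j hij => ?_⟩
  rw [comp2_fieldEqLhs, hbox, hhess2, hG.comp2_ricci_frame hr hF,
    frameMetric_none_mul_none (by omega), dot_frame (hG.symm y) hF,
    hG.comp2_riemannRicci_frame hy hn hF hr hW hij, hG.comp2_ricciRicci_frame hn hF hr hij,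
    hG.comp2_riemannRiemann_frame hy hn hF hr hW hij]
  ring

/-- The d'Alembertian of `μ g_{ab} + ε w_a w_b`. -/
theorem IsMetricOn.comp2_box2_radiation (hG : IsMetricOn G U) (hy : y ∈ U) {w : Field1 n}
    (hw : SmoothVec U w) {T : Field2 n} {μ ε : ℝ}
    (hT : ∀ z ∈ U, ∀ a b, T z a b = μ * G z a b + ε * (w z a * w z b)) (u v : Fin n → ℝ) :
    comp2 (box2 G T y) u v = ε *
      ((∑ c, ∑ d, ginv G y c d * ∑ a, nabla2 G (nabla1 G w) y c d a * u a) * (∑ a, w y a * v a)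
      + (∑ a, w y a * u a) * (∑ c, ∑ d, ginv G y c d * ∑ a, nabla2 G (nabla1 G w) y c d a * v a)
      + 2 * ∑ c, ∑ d, ginv G y c d * (∑ a, nabla1 G w y c a * u a)
        * (∑ a, nabla1 G w y d a * v a)) := by
  have h1 : comp2 (box2 G T y) u v = ∑ c, ∑ d, ε *
      ((ginv G y c d * ∑ a, nabla2 G (nabla1 G w) y c d a * u a) * (∑ a, w y a * v a)
      + (∑ a, w y a * u a) * (ginv G y c d * ∑ a, nabla2 G (nabla1 G w) y c d a * v a)
      + ginv G y c d * (∑ a, nabla1 G w y c a * u a) * (∑ a, nabla1 G w y d a * v a)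
      + ginv G y c d * (∑ a, nabla1 G w y d a * u a) * (∑ a, nabla1 G w y c a * v a)) := by
    simp only [comp2, box2]
    conv_lhs => simp only [Finset.sum_mul]
    rw [sum_comm_pairs]
    refine Finset.sum_congr rfl fun c _ => Finset.sum_congr rfl fun d _ => ?_
    have fac : ∀ p q : Fin n → ℝ, (∑ a, p a * u a) * (∑ b, q b * v b)
        = ∑ a, ∑ b, p a * q b * u a * v b := by
      intro p q
      rw [Finset.sum_mul_sum]
      exact Finset.sum_congr rfl fun _ _ => Finset.sum_congr rfl fun _ _ => by ring
    simp only [hG.nabla3_radiation hy hw hT]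
    rw [mul_assoc (ginv G y c d), mul_assoc (ginv G y c d), mul_assoc (ginv G y c d),
      mul_left_comm _ (ginv G y c d), fac, fac, fac, fac]
    simp only [Finset.mul_sum, ← Finset.sum_add_distrib]
    exact Finset.sum_congr rfl fun _ _ => Finset.sum_congr rfl fun _ _ => by ring
  have h2 : ∑ c, ∑ d, ginv G y c d * (∑ a, nabla1 G w y d a * u a) * (∑ a, nabla1 G w y c a * v a)
      = ∑ c, ∑ d, ginv G y c d * (∑ a, nabla1 G w y c a * u a)
        * (∑ a, nabla1 G w y d a * v a) := by
    rw [Finset.sum_comm]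
    exact Finset.sum_congr rfl fun _ _ => Finset.sum_congr rfl fun _ _ => by rw [hG.ginv_comm]
  rw [h1]
  simp only [← Finset.mul_sum, Finset.sum_add_distrib]
  rw [h2]
  simp only [← Finset.sum_mul]
  ring

theorem codot_mul_left (μ : ℝ) (p q : Fin n → ℝ) :
    codot G y (fun a => μ * p a) q = μ * codot G y p q := by
  simp only [codot, Finset.mul_sum]
  exact Finset.sum_congr rfl fun _ _ => Finset.sum_congr rfl fun _ _ => by ring

theorem IsMetricOn.codot_lower (hG : IsMetricOn G U) (hy : y ∈ U) (X : Fin n → ℝ) :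
    codot G y (fun a => ∑ c, G y a c * l c) X = ∑ a, l a * X a := by
  simp only [codot]
  rw [Finset.sum_comm]
  refine Finset.sum_congr rfl fun b _ => ?_
  rw [← Finset.sum_mul]
  congr 1
  simp only [Finset.mul_sum]
  rw [Finset.sum_comm]
  have : ∀ c, ∑ a, ginv G y a b * (G y a c * l c) = (if b = c then 1 else 0) * l c := by
    intro c
    rw [← hG.sum_ginv_mul hy b c, Finset.sum_mul]
    exact Finset.sum_congr rfl fun a _ => by rw [hG.ginv_comm y b a]; ring
  simp only [this]
  simp

/-- `∇^a (w_a w_b) = 0`, from the contracted Bianchi identity. -/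
theorem IsMetricOn.div_radiation (hG : IsMetricOn G U) (hy : y ∈ U) {w : Field1 n}
    (hw : SmoothVec U w) (h0 : ∀ z ∈ U, codot G z (w z) (w z) = 0) {ε : ℝ} (hε : ε ≠ 0)
    (hric : ∀ z ∈ U, ∀ a b, ricci G z a b = r * G z a b + ε * (w z a * w z b)) (f : Fin n) :
    (∑ b, ∑ d, ginv G y b d * nabla1 G w y d b) * w y f
      + codot G y (w y) (fun d => nabla1 G w y d f) = 0 := by
  have h := hG.contracted_bianchi hy f
  simp only [hG.nabla2_radiation hy hw hric] at h
  have h1 : ∑ b, ∑ d, ginv G y b d * (ε * (nabla1 G w y f b * w y d + w y b * nabla1 G w y f d))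
      = ε * (codot G y (nabla1 G w y f) (w y) + codot G y (w y) (nabla1 G w y f)) := by
    simp only [codot, Finset.mul_sum, ← Finset.sum_add_distrib]
    exact Finset.sum_congr rfl fun _ _ => Finset.sum_congr rfl fun _ _ => by ring
  have h2 : ∑ b, ∑ d, ginv G y b d * (ε * (nabla1 G w y d b * w y f + w y b * nabla1 G w y d f))
      = ε * ((∑ b, ∑ d, ginv G y b d * nabla1 G w y d b) * w y f
      + codot G y (w y) (fun d => nabla1 G w y d f)) := by
    simp only [codot, Finset.mul_sum, Finset.sum_mul, ← Finset.sum_add_distrib]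
    exact Finset.sum_congr rfl fun _ _ => Finset.sum_congr rfl fun _ _ => by ring
  rw [h1, h2, hG.codot_comm (nabla1 G w y f), hG.codot_nabla1 hy hw h0] at h
  have h3 : ε * ((∑ b, ∑ d, ginv G y b d * nabla1 G w y d b) * w y f
      + codot G y (w y) (fun d => nabla1 G w y d f)) = 0 := by linarith
  exact (mul_eq_zero.1 h3).resolve_left hε

/-- Aligned null radiation `Ric = r g + ε w ⊗ w` solving the field equations, with a Weyl tensor of
negative boost weight, is affinely geodetic and has vanishing optical matrix. -/
theorem IsMetricOn.kundt_of_fieldEq (hG : IsMetricOn G U) (hy : y ∈ U) (hn : 4 ≤ n) {w : Field1 n}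
    (hw : SmoothVec U w) (h0 : ∀ z ∈ U, codot G z (w z) (w z) = 0) {ε : ℝ} (hε : ε ≠ 0)
    (hric : ∀ z ∈ U, ∀ a b, ricci G z a b = r * G z a b + ε * (w z a * w z b))
    (hS : ∀ z ∈ U, scalarCurv G z = n * r) (hF : IsNullFrame (G y) l k m) {μ : ℝ} (hμ : μ ≠ 0)
    (hwl : ∀ a, w y a = μ * ∑ c, G y a c * l c)
    (hW : OnlyNegativeBoostWeight (weyl G y) l k m) {α β γ κ Λ₀ : ℝ} (hβ : β ≠ 0)
    (heq : ∀ a b, fieldEqLhs G α β γ κ Λ₀ y a b = 0) :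
    (∀ a, ∑ b, nabla1 G w y b a * l b = 0) ∧
      ∀ u v, dot (G y) l u = 0 → dot (G y) l v = 0 → comp2 (nabla1 G w y) u v = 0 := by
  have hn4 : (4 : ℝ) ≤ n := by exact_mod_cast hn
  have hwfun : w y = fun a => μ * ∑ c, G y a c * l c := funext hwl
  have hcod : ∀ X, codot G y (w y) X = μ * ∑ a, l a * X a := by
    intro X
    rw [← hG.codot_lower hy X, hwfun, codot_mul_left]
  have hr : IsRadiationAt G l r (ε * μ ^ 2) y := fun a b => by
    rw [hric y hy, hwl a, hwl b]; ring
  -- the frame components of `∇w`; the first index is that of the derivative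
  set W : FrameIndex n → FrameIndex n → ℝ := fun γ δ =>
    comp2 (nabla1 G w y) (frame l k m γ) (frame l k m δ)
  have hW1 : ∀ γ, W γ none = 0 := by
    intro γ
    have h1 : ∀ c, ∑ a, nabla1 G w y c a * l a = 0 := by
      intro c
      have h := hG.codot_nabla1 hy hw h0 c
      rw [hcod] at h
      rw [← (mul_eq_zero.1 h).resolve_left hμ]
      exact Finset.sum_congr rfl fun _ _ => mul_comm _ _
    simp only [W, comp2]
    refine Finset.sum_eq_zero fun c _ => ?_
    have : ∀ a, nabla1 G w y c a * frame l k m γ c * frame l k m none a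
        = frame l k m γ c * (nabla1 G w y c a * l a) := fun a => by simp only [frame]; ring
    simp only [this, ← Finset.mul_sum, h1, mul_zero]
  have hwF : ∀ γ, ∑ a, w y a * frame l k m γ a = μ * frameMetric none γ := by
    intro γ
    rw [← dot_frame (hG.symm y) hF none γ]
    change _ = μ * dot (G y) l _
    rw [← hG.sum_lower_mul, Finset.mul_sum]
    exact Finset.sum_congr rfl fun a _ => by rw [hwl]; ring
  set D : ℝ := ∑ b, ∑ d, ginv G y b d * nabla1 G w y d b with hD
  have hdiv : ∀ f, D * w y f + μ * ∑ d, nabla1 G w y d f * l d = 0 := by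
    intro f
    rw [← hG.div_radiation hy hw h0 hε hric f, hcod]
    congr 2
    exact Finset.sum_congr rfl fun _ _ => mul_comm _ _
  have hW2 : ∀ γ, W none γ = -D * frameMetric none γ := by
    intro γ
    have h1 : ∑ f, (D * w y f + μ * ∑ d, nabla1 G w y d f * l d) * frame l k m γ f = 0 := by
      simp only [hdiv, zero_mul, Finset.sum_const_zero]
    have h2 : ∑ f, (D * w y f + μ * ∑ d, nabla1 G w y d f * l d) * frame l k m γ f
        = D * (∑ f, w y f * frame l k m γ f) + μ * W none γ := by
      have e : W none γ = ∑ f, (∑ d, nabla1 G w y d f * l d) * frame l k m γ f := by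
        simp only [W, comp2, Finset.sum_mul]
        rw [Finset.sum_comm]
        rfl
      rw [e, Finset.mul_sum, Finset.mul_sum, ← Finset.sum_add_distrib]
      exact Finset.sum_congr rfl fun _ _ => by ring
    rw [h2, hwF] at h1
    have h3 : μ * (W none γ + D * frameMetric none γ) = 0 := by linarith
    linarith [(mul_eq_zero.1 h3).resolve_left hμ]
  have hWm : ∀ i, W none (some (some i)) = 0 := fun i => by
    rw [hW2, frameMetric_eq_zero (by simp [weight]), mul_zero]
  have hT : ∀ z ∈ U, ∀ a b, ricci G z a b - (1 / 2) * scalarCurv G z * G z a b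
      = (r - (1 / 2) * (n * r)) * G z a b + ε * (w z a * w z b) := fun z hz a b => by
    rw [hric z hz, hS z hz]; ring
  obtain ⟨A, hA⟩ := hG.comp2_fieldEqLhs_frame hy hn hS hF hr hW α β γ κ Λ₀
  have hzero : ∀ u v, comp2 (fieldEqLhs G α β γ κ Λ₀ y) u v = 0 := fun u v => by
    simp only [comp2, heq, zero_mul, Finset.sum_const_zero]
  simp only [hzero, hG.comp2_box2_radiation hy hw hT, hwF] at hA
  -- the contraction over the derivative index, in the frame
  have hWW : ∀ γ δ, ∑ c, ∑ d, ginv G y c d * (∑ a, nabla1 G w y c a * frame l k m γ a)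
      * (∑ a, nabla1 G w y d a * frame l k m δ a) = ∑ ρ, W ρ γ * W (dual ρ) δ := by
    intro γ δ
    have e : ∀ ρ γ, W ρ γ = ∑ c, (∑ a, nabla1 G w y c a * frame l k m γ a) * frame l k m ρ c := by
      intro ρ γ
      simp only [W, comp2, Finset.sum_mul]
      exact Finset.sum_congr rfl fun _ _ => Finset.sum_congr rfl fun _ _ => by ring
    simp only [e]
    exact sum_inv_mul_mul (by omega) (hG.symm y) hF _ _
  have hmm : ∀ p q, ∑ ρ, W ρ (some (some p)) * W (dual ρ) (some (some q))
      = ∑ i, W (some (some i)) (some (some p)) * W (some (some i)) (some (some q)) := by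
    intro p q
    rw [FrameIndex.sum_eq]
    simp only [dual, hWm]
    ring
  set N : ℝ := ∑ p, ∑ i, W (some (some i)) (some (some p)) ^ 2 with hN
  have hmn : ∀ p : Fin (n - 2), frameMetric none (some (some p)) = 0 := fun p =>
    frameMetric_eq_zero (by simp [weight])
  have hA1 : ∀ p, A + 2 * (β * ε) * ∑ i, W (some (some i)) (some (some p)) ^ 2 = 0 := by
    intro p
    have h := hA (some (some p)) (some (some p)) (by simp [weight])
    rw [hWW, hmm, hmn] at h
    have h1 : frameMetric (some (some p)) (some (some p) : FrameIndex n) = 1 := if_pos rfl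
    rw [h1] at h
    simp only [pow_two]
    linarith
  -- On the `(l, k)` component, `l^a □w_a = -∇_c w_a ∇^c w^a` up to the factor between `w` and `l`.
  have hA2 : A - β * ε * N = 0 := by
    have h := hA none (some none) (by simp [weight])
    have h1 : frameMetric none (some none : FrameIndex n) = 1 := if_pos rfl
    have h2 : frameMetric none (none : FrameIndex n) = 0 := frameMetric_eq_zero (by simp [weight])
    rw [hWW, h1, h2] at h
    simp only [hW1, zero_mul, Finset.sum_const_zero] at h
    have h3 : (∑ c, ∑ d, ginv G y c d * ∑ a, nabla2 G (nabla1 G w) y c d a * frame l k m none a) * μ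
        = -N := by
      have e1 : ∀ c d, (∑ a, nabla2 G (nabla1 G w) y c d a * frame l k m none a) * μ
          = -codot G y (nabla1 G w y c) (nabla1 G w y d) := by
        intro c d
        rw [← hG.codot_nabla2 hy hw h0, hcod, mul_comm]
        congr 1
        exact Finset.sum_congr rfl fun _ _ => mul_comm _ _
      have e2 : ∀ c d, codot G y (nabla1 G w y c) (nabla1 G w y d)
          = ∑ δ, (∑ a, nabla1 G w y c a * frame l k m δ a)
            * ∑ a, nabla1 G w y d a * frame l k m (dual δ) a := fun c d =>
        sum_inv_mul_mul (by omega) (hG.symm y) hF _ _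
      have e3 : ∑ c, ∑ d, ginv G y c d * codot G y (nabla1 G w y c) (nabla1 G w y d) = N := by
        have e4 : ∑ c, ∑ d, ginv G y c d * codot G y (nabla1 G w y c) (nabla1 G w y d)
            = ∑ δ, ∑ ρ, W ρ δ * W (dual ρ) (dual δ) := by
          simp only [← hWW, e2]
          simp only [Finset.mul_sum (Finset.univ : Finset (FrameIndex n)), ← mul_assoc]
          rw [Finset.sum_congr rfl fun _ _ => Finset.sum_comm, Finset.sum_comm]
        rw [e4, FrameIndex.sum_eq]
        simp only [hW1, dual_none, dual_some_none, dual_some_some, hmm, zero_mul, mul_zero, Finset.sum_const_zero, zero_add, hN, pow_two]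
      rw [← e3, Finset.sum_mul, ← Finset.sum_neg_distrib]
      refine Finset.sum_congr rfl fun c _ => ?_
      rw [Finset.sum_mul, ← Finset.sum_neg_distrib]
      exact Finset.sum_congr rfl fun d _ => by rw [mul_assoc, e1]; ring
    rw [mul_comm μ 1, one_mul] at h
    rw [h3] at h
    linarith
  have hcard : ∑ p : Fin (n - 2), (A + 2 * (β * ε) * ∑ i, W (some (some i)) (some (some p)) ^ 2)
      = ((n : ℝ) - 2) * A + 2 * (β * ε) * N := by
    rw [Finset.sum_add_distrib, ← Finset.mul_sum, hN]
    simp [Nat.cast_sub (show 2 ≤ n by omega)]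
  simp only [hA1, Finset.sum_const_zero] at hcard
  have hN0 : N = 0 := by
    have h1 : (n : ℝ) * (β * ε) * N = 0 := by
      have : A = β * ε * N := by linarith
      rw [this] at hcard; linarith
    have h2 : (n : ℝ) * (β * ε) ≠ 0 := mul_ne_zero (by linarith) (mul_ne_zero hβ hε)
    exact (mul_eq_zero.1 h1).resolve_left h2
  have hL : ∀ i j, W (some (some i)) (some (some j)) = 0 := by
    intro i j
    have h1 := (Finset.sum_eq_zero_iff_of_nonneg
      (fun p _ => Finset.sum_nonneg fun i _ => sq_nonneg _)).1 hN0 j (Finset.mem_univ _)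
    have h2 := (Finset.sum_eq_zero_iff_of_nonneg (fun i _ => sq_nonneg _)).1 h1 i
      (Finset.mem_univ _)
    exact pow_eq_zero_iff two_ne_zero |>.1 h2
  -- The divergence is now `D = W_{01}`, while the Bianchi identity gives `W_{01} = -D`.
  have hD0 : D = 0 := by
    have e : D = ∑ γ, W (dual γ) γ := by
      have h := sum_inv_mul (by omega) (hG.symm y) hF (fun b d => nabla1 G w y d b)
      rw [hD]
      simp only [ginv]
      rw [h]
      exact Finset.sum_congr rfl fun γ _ => by rw [comp2_swap]
    rw [FrameIndex.sum_eq] at e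
    simp only [dual, hW1, hL, Finset.sum_const_zero, hW2] at e
    have h1 : frameMetric none (some none : FrameIndex n) = 1 := if_pos rfl
    rw [h1] at e
    linarith
  refine ⟨fun a => ?_, fun u v hu hv => ?_⟩
  · have h := hdiv a
    rw [hD0, zero_mul, zero_add] at h
    exact (mul_eq_zero.1 h).resolve_left hμ
  · have hW0 : ∀ γ, W none γ = 0 := fun γ => by rw [hW2, hD0, neg_zero, zero_mul]
    have hu' : dot (G y) (frame l k m none) u = 0 := hu
    have hv' : dot (G y) (frame l k m none) v = 0 := hv
    rw [comp2_eq_sum_frame (by omega) (hG.symm y) (hG.isUnit_det hy) hF]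
    refine Finset.sum_eq_zero fun α _ => Finset.sum_eq_zero fun β _ => ?_
    change _ * W α β = 0
    rcases α with _ | _ | i
    · rw [hW0, mul_zero]
    · rw [dual_some_none, hu', zero_mul, zero_mul]
    · rcases β with _ | _ | j
      · rw [hW1, mul_zero]
      · rw [dual_some_none, hv', mul_zero, zero_mul]
      · rw [hL, mul_zero]

end Kundt

/-! ### Existence of null frames -/

section Existence

variable {n : ℕ}

theorem dot_sum_mul {g : Matrix (Fin n) (Fin n) ℝ} (b : Fin n → Fin n → ℝ) (x z : Fin n → ℝ) :
    dot g (fun a => ∑ i, x i * b i a) (fun a => ∑ i, z i * b i a)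
      = ∑ i, ∑ j, x i * z j * dot g (b i) (b j) := by
  simp only [dot]
  conv_rhs => simp only [Finset.mul_sum]
  rw [← sum_comm_pairs]
  refine Finset.sum_congr rfl fun a _ => Finset.sum_congr rfl fun c _ => ?_
  rw [mul_assoc, Finset.sum_mul_sum, Finset.mul_sum]
  refine Finset.sum_congr rfl fun i _ => ?_
  rw [Finset.mul_sum]
  exact Finset.sum_congr rfl fun j _ => by ring

/-- Every nonzero null vector of a Lorentzian scalar product is part of a null frame: if `l` is
`(c₀, c)` in an orthonormal basis, then `k` is `(-c₀, c) / (2 c₀²)`, and the `m i` form an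
orthonormal basis of the orthogonal complement of the spatial vector `c`. -/
theorem exists_isNullFrame (hn : 2 ≤ n) {g : Matrix (Fin n) (Fin n) ℝ} {b : Fin n → Fin n → ℝ}
    (hb : ∀ i j, dot g (b i) (b j) = if i = j then (if i.val = 0 then -1 else 1) else 0)
    {l : Fin n → ℝ} (hl0 : l ≠ 0) (hll : dot g l l = 0) {c : Fin n → ℝ}
    (hc : l = fun a => ∑ i, c i * b i a) :
    ∃ k m, IsNullFrame g l k m := by
  obtain ⟨N, rfl⟩ : ∃ N, n = N + 2 := ⟨n - 2, by omega⟩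
  have hdot : ∀ x z : Fin (N + 2) → ℝ,
      dot g (fun a => ∑ i, x i * b i a) (fun a => ∑ i, z i * b i a)
        = -(x 0 * z 0) + ∑ i : Fin (N + 1), x i.succ * z i.succ := by
    intro x z
    rw [dot_sum_mul]
    simp only [hb, mul_ite, mul_zero, Finset.sum_ite_eq, Finset.mem_univ, if_true]
    rw [Fin.sum_univ_succ]
    simp
  let cv : EuclideanSpace ℝ (Fin (N + 1)) := WithLp.toLp 2 fun i => c i.succ
  have hcv : ∀ i, cv i = c i.succ := fun i => rfl
  have hsq : c 0 * c 0 = ∑ i : Fin (N + 1), c i.succ * c i.succ := by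
    have h := hdot c c
    rw [← hc, hll] at h
    linarith
  have hc0 : c 0 ≠ 0 := by
    intro h0
    rw [h0, mul_zero, eq_comm, Finset.sum_eq_zero_iff_of_nonneg
      (fun i _ => mul_self_nonneg _)] at hsq
    refine hl0 ?_
    rw [hc]
    funext a
    refine Finset.sum_eq_zero fun i _ => ?_
    refine Fin.cases ?_ (fun j => ?_) i
    · rw [h0, zero_mul]
    · rw [mul_self_eq_zero.1 (hsq j (Finset.mem_univ _)), zero_mul]
  have hcv0 : cv ≠ 0 := by
    intro h0
    have h1 : ∀ i : Fin (N + 1), c i.succ = 0 := fun i => by rw [← hcv, h0]; rfl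
    simp only [h1, mul_zero, Finset.sum_const_zero, mul_self_eq_zero] at hsq
    exact hc0 hsq
  have : Fact (Module.finrank ℝ (EuclideanSpace ℝ (Fin (N + 1))) = N + 1) := ⟨by simp⟩
  let o := OrthonormalBasis.fromOrthogonalSpanSingleton (𝕜 := ℝ) N hcv0
  have hoo : ∀ i j, ∑ p, (o i : EuclideanSpace ℝ (Fin (N + 1))) p
      * (o j : EuclideanSpace ℝ (Fin (N + 1))) p = if i = j then 1 else 0 := by
    intro i j
    have h := (orthonormal_iff_ite.1 o.orthonormal) i j
    rw [Submodule.coe_inner, PiLp.inner_apply] at h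
    rw [← h]
    exact Finset.sum_congr rfl fun p _ => by simp [mul_comm]
  have hoc : ∀ i, ∑ p, c p.succ * (o i : EuclideanSpace ℝ (Fin (N + 1))) p = 0 := by
    intro i
    have h := Submodule.mem_orthogonal_singleton_iff_inner_right.1 (o i).2
    rw [PiLp.inner_apply] at h
    rw [← h]
    exact Finset.sum_congr rfl fun p _ => by simp [mul_comm, hcv]
  let kc : Fin (N + 2) → ℝ := Fin.cons (-(c 0) / (2 * (c 0 * c 0)))
    (fun p => c p.succ / (2 * (c 0 * c 0)))
  let mc : Fin N → Fin (N + 2) → ℝ := fun i =>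
    Fin.cons 0 (fun p => (o i : EuclideanSpace ℝ (Fin (N + 1))) p)
  refine ⟨fun a => ∑ i, kc i * b i a, fun i a => ∑ j, mc i j * b j a, ?_⟩
  constructor
  · exact hll
  · rw [hdot]
    simp only [kc, Fin.cons_zero, Fin.cons_succ]
    have e : ∀ p : Fin (N + 1), c p.succ / (2 * (c 0 * c 0)) * (c p.succ / (2 * (c 0 * c 0)))
        = c p.succ * c p.succ * (1 / (2 * (c 0 * c 0)) ^ 2) := fun p => by ring
    simp only [e, ← Finset.sum_mul, ← hsq]
    ring
  · rw [hc, hdot]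
    simp only [kc, Fin.cons_zero, Fin.cons_succ]
    have e : ∀ p : Fin (N + 1), c p.succ / (2 * (c 0 * c 0)) * c p.succ
        = c p.succ * c p.succ * (1 / (2 * (c 0 * c 0))) := fun p => by ring
    simp only [e, ← Finset.sum_mul, ← hsq]
    field_simp
    norm_num
  · intro i
    rw [hc]
    refine (hdot _ (mc i)).trans ?_
    simp only [mc, Fin.cons_zero, Fin.cons_succ, hoc]
    ring
  · intro i
    refine (hdot kc (mc i)).trans ?_
    simp only [kc, mc, Fin.cons_zero, Fin.cons_succ]
    have e : ∀ p : Fin (N + 1), c p.succ / (2 * (c 0 * c 0))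
        * (o i : EuclideanSpace ℝ (Fin (N + 1))) p
        = c p.succ * (o i : EuclideanSpace ℝ (Fin (N + 1))) p * (1 / (2 * (c 0 * c 0))) :=
      fun p => by ring
    simp only [e, ← Finset.sum_mul, hoc]
    ring
  · intro i j
    refine (hdot (mc i) (mc j)).trans ?_
    simp only [mc, Fin.cons_zero, Fin.cons_succ]
    rw [mul_zero, neg_zero, zero_add]
    exact hoo i j

end Existence

/-! ### Metric and vector fields in charts -/

section Charts

variable {n : ℕ} {M : Type*} [TopologicalSpace M] [ChartedSpace (EuclideanSpace ℝ (Fin n)) M]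

theorem mdifferentiable_of_mem_maximalAtlas {e : Chart n M}
    (he : e ∈ IsManifold.maximalAtlas (𝓡 n) ∞ M) : e.MDifferentiable (𝓡 n) (𝓡 n) :=
  ⟨(contMDiffOn_of_mem_maximalAtlas he).mdifferentiableOn (by simp),
    (contMDiffOn_symm_of_mem_maximalAtlas he).mdifferentiableOn (by simp)⟩

/-- The components of a tangent vector in a chart. -/
noncomputable def tangentCoords (e : Chart n M) (y : Coord n) (X : TangentSpace (𝓡 n) (e.symm y)) : Fin n → ℝ :=
  fun a => (show EuclideanSpace ℝ (Fin n) from mfderiv (𝓡 n) (𝓡 n) e (e.symm y) X) a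

/-- The coordinate vector `∂_a`. -/
noncomputable def coordVec (e : Chart n M) (y : Coord n) (a : Fin n) :
    TangentSpace (𝓡 n) (e.symm y) :=
  mfderiv (𝓡 n) (𝓡 n) e.symm y (EuclideanSpace.single a (1 : ℝ) : EuclideanSpace ℝ (Fin n))

theorem sum_tangentCoords_smul {e : Chart n M} (he : e ∈ IsManifold.maximalAtlas (𝓡 n) ∞ M)
    {y : Coord n} (hy : y ∈ e.target) (X : TangentSpace (𝓡 n) (e.symm y)) :
    ∑ a, tangentCoords e y X a • coordVec e y a = X := by
  have h := (mdifferentiable_of_mem_maximalAtlas he).symm_comp_deriv (e.map_target hy)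
  rw [e.right_inv hy] at h
  have h1 : mfderiv (𝓡 n) (𝓡 n) e.symm y (mfderiv (𝓡 n) (𝓡 n) e (e.symm y) X) = X :=
    DFunLike.congr_fun h X
  let v : EuclideanSpace ℝ (Fin n) := mfderiv (𝓡 n) (𝓡 n) e (e.symm y) X
  have h2 : ∑ a, v a • (EuclideanSpace.single a (1 : ℝ) : EuclideanSpace ℝ (Fin n)) = v := by
    ext i
    simp [Pi.single_apply]
  conv_rhs => rw [← h1]
  let L : EuclideanSpace ℝ (Fin n) →L[ℝ] TangentSpace (𝓡 n) (e.symm y) :=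
    mfderiv (𝓡 n) (𝓡 n) e.symm y
  change ∑ a, v a • L (EuclideanSpace.single a (1 : ℝ)) = L v
  conv_rhs => rw [← h2, map_sum]
  simp only [map_smul]

theorem vecInChart_smul (c : M → ℝ) (l : ∀ p : M, TangentSpace (𝓡 n) p) (e : Chart n M)
    (y : Coord n) (a : Fin n) :
    vecInChart (fun p => c p • l p) e y a = c (e.symm y) * vecInChart l e y a := by
  let L : TangentSpace (𝓡 n) (e.symm y) →L[ℝ] EuclideanSpace ℝ (Fin n) :=
    mfderiv (𝓡 n) (𝓡 n) e (e.symm y)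
  change L (c (e.symm y) • l (e.symm y)) a = c (e.symm y) * L (l (e.symm y)) a
  rw [map_smul]; rfl

/-- The derivative along a vector field in coordinates. -/
theorem derivAlong_eq_sum {e : Chart n M} (he : e ∈ IsManifold.maximalAtlas (𝓡 n) ∞ M)
    {y : Coord n} (hy : y ∈ e.target) (l : ∀ p : M, TangentSpace (𝓡 n) p) {f : M → ℝ}
    (hf : MDifferentiableAt (𝓡 n) 𝓘(ℝ, ℝ) f (e.symm y)) :
    derivAlong l f (e.symm y) = ∑ a, pd (fun z => f (e.symm z)) a y * vecInChart l e y a := by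
  have hd := (mdifferentiable_of_mem_maximalAtlas he).mdifferentiableAt_symm hy
  have h1 : mfderiv (𝓡 n) 𝓘(ℝ, ℝ) (f ∘ e.symm) y =
      (mfderiv (𝓡 n) 𝓘(ℝ, ℝ) f (e.symm y)).comp (mfderiv (𝓡 n) (𝓡 n) e.symm y) :=
    mfderiv_comp y hf hd
  have h2 : ∀ a, pd (fun z => f (e.symm z)) a y
      = mfderiv (𝓡 n) 𝓘(ℝ, ℝ) f (e.symm y) (coordVec e y a) := by
    intro a
    have h3 : fderiv ℝ (f ∘ e.symm) y = _ := mfderiv_eq_fderiv.symm.trans h1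
    exact DFunLike.congr_fun h3 (EuclideanSpace.single a (1 : ℝ))
  rw [derivAlong]
  conv_lhs => rw [← sum_tangentCoords_smul he hy (l (e.symm y)), map_sum]
  refine Finset.sum_congr rfl fun a _ => ?_
  rw [h2, map_smul]
  exact mul_comm (vecInChart l e y a) _

variable [IsManifold (𝓡 n) ∞ M] (g : LorentzMetric n M)

theorem inChart_apply (e : Chart n M) (y : Coord n) (a b : Fin n) :
    g.inChart e y a b = g.inner (e.symm y) (coordVec e y a) (coordVec e y b) := rfl

theorem inChart_symm (e : Chart n M) (y : Coord n) (a b : Fin n) :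
    g.inChart e y a b = g.inChart e y b a := g.symm _ _ _

theorem sum_inChart_mul {e : Chart n M} (he : e ∈ IsManifold.maximalAtlas (𝓡 n) ∞ M)
    {y : Coord n} (hy : y ∈ e.target) (X : TangentSpace (𝓡 n) (e.symm y)) (a : Fin n) :
    ∑ b, g.inChart e y a b * tangentCoords e y X b = g.inner (e.symm y) (coordVec e y a) X := by
  conv_rhs => rw [← sum_tangentCoords_smul he hy X, map_sum]
  exact Finset.sum_congr rfl fun b _ => by rw [map_smul, smul_eq_mul, inChart_apply, mul_comm]

theorem dot_inChart {e : Chart n M} (he : e ∈ IsManifold.maximalAtlas (𝓡 n) ∞ M)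
    {y : Coord n} (hy : y ∈ e.target) (X Y : TangentSpace (𝓡 n) (e.symm y)) :
    dot (g.inChart e y) (tangentCoords e y X) (tangentCoords e y Y) = g.inner (e.symm y) X Y := by
  conv_rhs => rw [← sum_tangentCoords_smul he hy X, map_sum, sum_apply]
  refine Finset.sum_congr rfl fun a _ => ?_
  rw [map_smul, smul_apply, smul_eq_mul, ← sum_inChart_mul g he hy,
    Finset.mul_sum]
  exact Finset.sum_congr rfl fun b _ => by ring

/-- The Lorentzian basis of the tangent space, in coordinates. -/
theorem exists_lorentz_coords {e : Chart n M} (he : e ∈ IsManifold.maximalAtlas (𝓡 n) ∞ M)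
    {y : Coord n} (hy : y ∈ e.target) :
    ∃ b : Fin n → Fin n → ℝ,
      (∀ i j, dot (g.inChart e y) (b i) (b j)
        = if i = j then (if i.val = 0 then -1 else 1) else 0) ∧
      ∀ X : TangentSpace (𝓡 n) (e.symm y), ∃ c : Fin n → ℝ,
        tangentCoords e y X = fun a => ∑ i, c i * b i a := by
  obtain ⟨b, hb⟩ := g.lorentzian (e.symm y)
  refine ⟨fun i => tangentCoords e y (b i), fun i j => ?_, fun X => ⟨fun i => b.repr X i, ?_⟩⟩
  · rw [dot_inChart g he hy, hb]
  · funext a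
    let L : TangentSpace (𝓡 n) (e.symm y) →L[ℝ] EuclideanSpace ℝ (Fin n) :=
      mfderiv (𝓡 n) (𝓡 n) e (e.symm y)
    change L X a = ∑ i, b.repr X i * L (b i) a
    conv_lhs => rw [← b.sum_repr X, map_sum]
    simp

theorem inChart_det_ne_zero {e : Chart n M} (he : e ∈ IsManifold.maximalAtlas (𝓡 n) ∞ M)
    {y : Coord n} (hy : y ∈ e.target) : (g.inChart e y).det ≠ 0 := by
  obtain ⟨b, hb, -⟩ := exists_lorentz_coords g he hy
  let B : Matrix (Fin n) (Fin n) ℝ := Matrix.of b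
  have h : B * g.inChart e y * B.transpose
      = Matrix.diagonal fun i => if i.val = 0 then -1 else 1 := by
    ext i j
    rw [Matrix.diagonal_apply, ← hb, Matrix.mul_assoc]
    simp only [Matrix.mul_apply, dot, Finset.mul_sum, B, Matrix.of_apply, Matrix.transpose_apply]
    exact Finset.sum_congr rfl fun _ _ => Finset.sum_congr rfl fun _ _ => by ring
  intro h0
  have h1 := congrArg Matrix.det h
  rw [Matrix.det_mul, Matrix.det_mul, h0, Matrix.det_diagonal, mul_zero, zero_mul, eq_comm,
    Finset.prod_eq_zero_iff] at h1
  obtain ⟨i, -, hi⟩ := h1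
  split_ifs at hi <;> norm_num at hi

/-- The coordinate vector fields are smooth. -/
theorem contMDiffOn_coordVec {e : Chart n M} (he : e ∈ IsManifold.maximalAtlas (𝓡 n) ∞ M)
    (a : Fin n) :
    ContMDiffOn (𝓡 n) (𝓡 n).tangent ∞
      (fun y => (⟨e.symm y, coordVec e y a⟩ : TangentBundle (𝓡 n) M)) e.target := by
  have h1 := (contMDiffOn_symm_of_mem_maximalAtlas he).contMDiffOn_tangentMapWithin
    (m := ∞) (by simp) e.open_target.uniqueMDiffOn
  have h2 : ContMDiffOn (𝓡 n) (𝓡 n).tangent ∞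
      (fun y : EuclideanSpace ℝ (Fin n) =>
        (⟨y, (EuclideanSpace.single a (1 : ℝ) : EuclideanSpace ℝ (Fin n))⟩ :
          TangentBundle (𝓡 n) (EuclideanSpace ℝ (Fin n)))) e.target := by
    intro y _
    exact contMDiffWithinAt_vectorSpace_iff_contDiffWithinAt.2 contDiffWithinAt_const
  refine (h1.comp h2 (fun y hy => hy)).congr fun y hy => ?_
  simp only [Function.comp, tangentMapWithin, coordVec]
  rw [mfderivWithin_of_isOpen e.open_target hy]

theorem contDiffOn_inner {e : Chart n M} (he : e ∈ IsManifold.maximalAtlas (𝓡 n) ∞ M)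
    {V W : ∀ y : Coord n, TangentSpace (𝓡 n) (e.symm y)}
    (hV : ContMDiffOn (𝓡 n) (𝓡 n).tangent ∞
      (fun y => (⟨e.symm y, V y⟩ : TangentBundle (𝓡 n) M)) e.target)
    (hW : ContMDiffOn (𝓡 n) (𝓡 n).tangent ∞
      (fun y => (⟨e.symm y, W y⟩ : TangentBundle (𝓡 n) M)) e.target) :
    ContDiffOn ℝ ∞ (fun y => g.inner (e.symm y) (V y) (W y)) e.target := by
  rw [← contMDiffOn_iff_contDiffOn]
  have hg := g.contMDiff.comp_contMDiffOn (contMDiffOn_symm_of_mem_maximalAtlas he)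
  intro y hy
  have h := ContMDiffWithinAt.clm_bundle_apply₂ (E₁ := fun p : M => TangentSpace (𝓡 n) p)
    (E₂ := fun p : M => TangentSpace (𝓡 n) p) (E₃ := Bundle.Trivial M ℝ) (F₁ := EuclideanSpace ℝ (Fin n))
    (F₂ := EuclideanSpace ℝ (Fin n)) (F₃ := ℝ) (hg y hy) (hV y hy) (hW y hy)
  simp only [Bundle.contMDiffWithinAt_totalSpace] at h
  exact h.2

theorem isMetricOn_inChart {e : Chart n M} (he : e ∈ IsManifold.maximalAtlas (𝓡 n) ∞ M) :
    IsMetricOn (g.inChart e) e.target where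
  isOpen := e.open_target
  symm _ _ _ := inChart_symm g e _ _ _
  det_ne _ hz := inChart_det_ne_zero g he hz
  smooth a b := contDiffOn_inner g he (contMDiffOn_coordVec he a) (contMDiffOn_coordVec he b)

theorem IsMetricOn.mono {G : MetricField n} {U V : Set (Coord n)} (hG : IsMetricOn G U)
    (hV : IsOpen V) (h : V ⊆ U) : IsMetricOn G V :=
  ⟨hV, hG.symm, fun z hz => hG.det_ne z (h hz), fun a b => (hG.smooth a b).mono h⟩

theorem smoothVec_lower {l : ∀ p : M, TangentSpace (𝓡 n) p}
    (hl : ContMDiff (𝓡 n) (𝓡 n).tangent ∞ (fun p => (⟨p, l p⟩ : TangentBundle (𝓡 n) M)))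
    {e : Chart n M} (he : e ∈ IsManifold.maximalAtlas (𝓡 n) ∞ M) :
    SmoothVec e.target (lower (g.inChart e) (vecInChart l e)) := fun a =>
  (contDiffOn_inner g he (contMDiffOn_coordVec he a)
    (hl.comp_contMDiffOn (contMDiffOn_symm_of_mem_maximalAtlas he))).congr fun y hy =>
      sum_inChart_mul g he hy (l (e.symm y)) a

end Charts

/-! ### Aligned null radiation in quadratic gravity -/

section Radiation

variable {n : ℕ}

theorem nabla1_mul {G : MetricField n} {y : Coord n} {f : Coord n → ℝ} {p : Field1 n}
    (hf : DifferentiableAt ℝ f y) (hp : ∀ a, DifferentiableAt ℝ (fun z => p z a) y)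
    (c a : Fin n) :
    nabla1 G (fun z a => f z * p z a) y c a = pd f c y * p y a + f y * nabla1 G p y c a := by
  simp only [nabla1]
  rw [pd_mul hf (hp a), mul_sub, Finset.mul_sum]
  have e : ∀ d, christoffel G y d c a * (f y * p y d)
      = f y * (christoffel G y d c a * p y d) := fun d => by ring
  simp only [e]
  ring

variable {M : Type*} [TopologicalSpace M] [ChartedSpace (EuclideanSpace ℝ (Fin n)) M]

theorem contMDiff_sqrt_abs {Φ : M → ℝ} (hΦ : ContMDiff (𝓡 n) 𝓘(ℝ, ℝ) ∞ Φ) (hΦ0 : ∀ p, Φ p ≠ 0) :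
    ContMDiff (𝓡 n) 𝓘(ℝ, ℝ) ∞ fun p => Real.sqrt |Φ p| := fun p =>
  (((contDiffAt_abs (hΦ0 p)).sqrt (abs_ne_zero.2 (hΦ0 p))).contMDiffAt (n := ∞)).comp p (hΦ p)

/-- The sign of a nowhere vanishing continuous function is locally constant. -/
theorem exists_sign {Φ : M → ℝ} (hΦ : Continuous Φ) (hΦ0 : ∀ p, Φ p ≠ 0) (p : M) :
    ∃ ε : ℝ, ε ≠ 0 ∧ IsOpen {q | 0 < ε * Φ q} ∧ 0 < ε * Φ p ∧
      ∀ q, 0 < ε * Φ q → Φ q = ε * Real.sqrt |Φ q| ^ 2 := by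
  have ho : ∀ ε : ℝ, IsOpen {q | 0 < ε * Φ q} := fun ε =>
    isOpen_lt continuous_const (continuous_const.mul hΦ)
  rcases lt_or_gt_of_ne (hΦ0 p) with h | h
  · refine ⟨-1, by norm_num, ho _, by linarith, fun q hq => ?_⟩
    rw [Real.sq_sqrt (abs_nonneg _), abs_of_neg (by linarith)]; ring
  · refine ⟨1, one_ne_zero, ho _, by linarith, fun q hq => ?_⟩
    rw [Real.sq_sqrt (abs_nonneg _), abs_of_pos (by linarith)]; ring

theorem contDiffOn_comp_symm {f : M → ℝ} {e : Chart n M} (hf : ContMDiff (𝓡 n) 𝓘(ℝ, ℝ) ∞ f)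
    (he : e ∈ IsManifold.maximalAtlas (𝓡 n) ∞ M) :
    ContDiffOn ℝ ∞ (fun z => f (e.symm z)) e.target :=
  contMDiffOn_iff_contDiffOn.1 (hf.comp_contMDiffOn (contMDiffOn_symm_of_mem_maximalAtlas he))

variable [IsManifold (𝓡 n) ∞ M] {g : LorentzMetric n M} {l : ∀ p : M, TangentSpace (𝓡 n) p}
  {e : Chart n M} {y : Coord n}

theorem lower_smul (c : M → ℝ) :
    lower (g.inChart e) (vecInChart (fun p => c p • l p) e)
      = fun z a => c (e.symm z) * lower (g.inChart e) (vecInChart l e) z a := by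
  funext z a
  simp only [lower, vecInChart_smul, Finset.mul_sum]
  exact Finset.sum_congr rfl fun b _ => by ring

theorem IsNullVectorField.exists_isNullFrame (hl : IsNullVectorField g l) (hn : 2 ≤ n)
    (he : e ∈ IsManifold.maximalAtlas (𝓡 n) ∞ M) (hy : y ∈ e.target) :
    ∃ k m, IsNullFrame (g.inChart e y) (vecInChart l e y) k m := by
  obtain ⟨b, hb, hspan⟩ := exists_lorentz_coords g he hy
  obtain ⟨c, hc⟩ := hspan (l (e.symm y))
  refine QuadraticGravity.exists_isNullFrame hn hb ?_ ?_ hc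
  · intro h0
    refine hl.ne_zero (e.symm y) ?_
    rw [← sum_tangentCoords_smul he hy (l (e.symm y))]
    refine Finset.sum_eq_zero fun a _ => ?_
    have : tangentCoords e y (l (e.symm y)) a = 0 := congrFun h0 a
    rw [this, zero_smul]
  · exact (dot_inChart g he hy _ _).trans (hl.null _)

theorem IsNullVectorField.exists_lower_ne_zero (hl : IsNullVectorField g l) (hn : 2 ≤ n)
    (he : e ∈ IsManifold.maximalAtlas (𝓡 n) ∞ M) (hy : y ∈ e.target) :
    ∃ a, lower (g.inChart e) (vecInChart l e) y a ≠ 0 := by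
  obtain ⟨k, m, hF⟩ := hl.exists_isNullFrame hn he hy
  by_contra! h
  have h1 := (isMetricOn_inChart g he).sum_lower_mul (y := y) (vecInChart l e y) k
  rw [dot_comm (inChart_symm g e y), hF.k_l] at h1
  have h2 : ∀ a, ∑ c, g.inChart e y a c * vecInChart l e y c = 0 := h
  simp only [h2, zero_mul, Finset.sum_const_zero] at h1
  exact zero_ne_one h1

variable {Φ : M → ℝ} {α β γ κ Λ₀ Λ : ℝ}

/-- The rescaled field `√|Φ| l` is affinely geodetic, and its covariant derivative vanishes on the
orthogonal complement of `l`. -/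
theorem rescaled_kundt (hn : 4 ≤ n) (hl : IsNullVectorField g l)
    (hΦ : ContMDiff (𝓡 n) 𝓘(ℝ, ℝ) ∞ Φ) (hΦ0 : ∀ p, Φ p ≠ 0) (hβ : β ≠ 0)
    (hsol : SolvesQuadraticGravity g α β γ κ Λ₀) (hric : HasNullRadiationRicci g l Λ Φ)
    (hweyl : IsWeylTypeIIIBOrNOrO g l) (he : e ∈ IsManifold.maximalAtlas (𝓡 n) ∞ M)
    (hy : y ∈ e.target) :
    (∀ a, ∑ b, nabla1 (g.inChart e)
      (fun z a => Real.sqrt |Φ (e.symm z)| * lower (g.inChart e) (vecInChart l e) z a) y b a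
        * vecInChart l e y b = 0) ∧
    ∀ u v, dot (g.inChart e y) (vecInChart l e y) u = 0 →
      dot (g.inChart e y) (vecInChart l e y) v = 0 → comp2 (nabla1 (g.inChart e)
        (fun z a => Real.sqrt |Φ (e.symm z)| * lower (g.inChart e) (vecInChart l e) z a) y) u v
          = 0 := by
  have hG := isMetricOn_inChart g he
  have hr : ∀ z ∈ e.target,
      IsRadiationAt (g.inChart e) (vecInChart l e z) (2 * Λ / ((n : ℝ) - 2)) (Φ (e.symm z)) z :=
    fun z hz a b => by rw [hric e he z hz a b, mul_assoc]; rfl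
  obtain ⟨ε, hε, hopen, hp, hsign⟩ := exists_sign hΦ.continuous hΦ0 (e.symm y)
  let U : Set (Coord n) := e.target ∩ e.symm ⁻¹' {q | 0 < ε * Φ q}
  have hU : IsOpen U := e.symm.isOpen_inter_preimage hopen
  have hGU : IsMetricOn (g.inChart e) U := hG.mono hU Set.inter_subset_left
  have hyU : y ∈ U := ⟨hy, hp⟩
  have hlow := smoothVec_lower g hl.smooth he
  have hw : SmoothVec U
      (fun z a => Real.sqrt |Φ (e.symm z)| * lower (g.inChart e) (vecInChart l e) z a) := fun a =>
    (((contDiffOn_comp_symm (contMDiff_sqrt_abs hΦ hΦ0) he).mul (hlow a))).mono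
      Set.inter_subset_left
  have hframe : ∃ k m, IsNullFrame (g.inChart e y) (vecInChart l e y) k m ∧
      OnlyNegativeBoostWeight (weyl (g.inChart e) y) (vecInChart l e y) k m := by
    rcases hweyl e he y hy with ⟨k, m, hF, hW, -⟩ | ⟨k, m, hF, hW, -⟩ | h0
    · exact ⟨k, m, hF, hW⟩
    · exact ⟨k, m, hF, hW⟩
    · obtain ⟨k, m, hF⟩ := hl.exists_isNullFrame (by omega) he hy
      have hC : ∀ u v w z, comp4 (weyl (g.inChart e) y) u v w z = 0 := fun u v w z => by
        simp only [comp4, h0 _ _ _ _, zero_mul, Finset.sum_const_zero]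
      exact ⟨k, m, hF, ⟨fun _ _ => hC _ _ _ _, fun _ _ _ => hC _ _ _ _,
        fun _ _ _ _ => hC _ _ _ _, fun _ _ => hC _ _ _ _⟩⟩
  obtain ⟨k, m, hF, hW⟩ := hframe
  refine hGU.kundt_of_fieldEq hyU hn hw (fun z hz => ?_) hε
    (r := 2 * Λ / ((n : ℝ) - 2)) (fun z hz a b => ?_) (fun z hz => ?_) hF
    (μ := Real.sqrt |Φ (e.symm y)|) (Real.sqrt_ne_zero'.2 (abs_pos.2 (hΦ0 _))) (fun a => rfl) hW hβ
    (fun a b => hsol e he y hy a b)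
  · rw [codot_mul_left, hG.codot_comm, codot_mul_left]
    have h1 := hG.codot_lower hz.1 (l := vecInChart l e z)
      (lower (g.inChart e) (vecInChart l e) z)
    have h2 : dot (g.inChart e z) (vecInChart l e z) (vecInChart l e z) = 0 :=
      (dot_inChart g he hz.1 _ _).trans (hl.null _)
    rw [← hG.sum_lower_mul] at h2
    have h3 : codot (g.inChart e) z (lower (g.inChart e) (vecInChart l e) z)
        (lower (g.inChart e) (vecInChart l e) z) = 0 := by
      refine h1.trans (Eq.trans ?_ h2)
      exact Finset.sum_congr rfl fun _ _ => mul_comm _ _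
    rw [h3, mul_zero, mul_zero]
  · rw [hric e he z hz.1 a b]
    linear_combination lower (g.inChart e) (vecInChart l e) z a
      * lower (g.inChart e) (vecInChart l e) z b * hsign _ hz.2
  · obtain ⟨k, m, hF⟩ := hl.exists_isNullFrame (by omega) he hz.1
    exact hG.scalarCurv_radiation (by omega) hF (hr z hz.1)

end Radiation

end QuadraticGravity

open QuadraticGravity

theorem mainTheorem8 {n : ℕ} (hn : 4 ≤ n)
    {M : Type*} [TopologicalSpace M] [ChartedSpace (EuclideanSpace ℝ (Fin n)) M]
    [IsManifold (𝓡 n) ∞ M]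
    (g : QuadraticGravity.LorentzMetric n M)
    (l : ∀ p : M, TangentSpace (𝓡 n) p) (hl : QuadraticGravity.IsNullVectorField g l)
    (Φ : M → ℝ) (hΦ : ContMDiff (𝓡 n) 𝓘(ℝ, ℝ) ∞ Φ) (hΦ0 : ∀ p, Φ p ≠ 0)
    (α β γ κ Λ₀ Λ : ℝ) (hκ : κ ≠ 0) (hβ : β ≠ 0)
    (hsol : QuadraticGravity.SolvesQuadraticGravity g α β γ κ Λ₀)
    (hric : QuadraticGravity.HasNullRadiationRicci g l Λ Φ)
    (hweyl : QuadraticGravity.IsWeylTypeIIIBOrNOrO g l) :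
    QuadraticGravity.IsKundt g ∧
    QuadraticGravity.IsGeodetic g l ∧
    QuadraticGravity.NonExpanding g l ∧
    QuadraticGravity.NonShearing g l ∧
    QuadraticGravity.NonTwisting g l ∧
    (QuadraticGravity.IsAffineGeodetic g l → ∀ p, QuadraticGravity.derivAlong l Φ p = 0) ∧
    (∃ c : M → ℝ, ContMDiff (𝓡 n) 𝓘(ℝ, ℝ) ∞ c ∧ (∀ p, 0 < c p) ∧
      QuadraticGravity.IsAffineGeodetic g (fun p => c p • l p) ∧
      ∀ p, QuadraticGravity.derivAlong (fun q => c q • l q) (fun q => Φ q / c q ^ 2) p = 0) := by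
  have hc := contMDiff_sqrt_abs hΦ hΦ0
  have hcpos : ∀ p, 0 < Real.sqrt |Φ p| := fun p => Real.sqrt_pos.2 (abs_pos.2 (hΦ0 p))
  -- Leibniz rule for `√|Φ| l`
  have hmul : ∀ e ∈ IsManifold.maximalAtlas (𝓡 n) ∞ M, ∀ y ∈ e.target, ∀ b a,
      nabla1 (g.inChart e) (fun z a => Real.sqrt |Φ (e.symm z)|
        * lower (g.inChart e) (vecInChart l e) z a) y b a
      = pd (fun z => Real.sqrt |Φ (e.symm z)|) b y * lower (g.inChart e) (vecInChart l e) y a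
        + Real.sqrt |Φ (e.symm y)| * nabla1 (g.inChart e) (lower (g.inChart e) (vecInChart l e))
          y b a := fun e he y hy b a =>
    nabla1_mul (differentiableAt_of_contDiffOn e.open_target (contDiffOn_comp_symm hc he) hy)
      (fun a => differentiableAt_of_contDiffOn e.open_target
        (smoothVec_lower g hl.smooth he a) hy) b a
  have key : ∀ e ∈ IsManifold.maximalAtlas (𝓡 n) ∞ M, ∀ y ∈ e.target, ∀ a,
      Real.sqrt |Φ (e.symm y)| * ∑ b, nabla1 (g.inChart e) (lower (g.inChart e) (vecInChart l e))
          y b a * vecInChart l e y b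
        = -(derivAlong l (fun p => Real.sqrt |Φ p|) (e.symm y)
          * lower (g.inChart e) (vecInChart l e) y a) := by
    intro e he y hy a
    have h := (rescaled_kundt hn hl hΦ hΦ0 hβ hsol hric hweyl he hy).1 a
    simp only [hmul e he y hy] at h
    rw [derivAlong_eq_sum he hy l ((hc _).mdifferentiableAt (by simp)), Finset.sum_mul,
      Finset.mul_sum, eq_neg_iff_add_eq_zero, ← Finset.sum_add_distrib, ← h]
    exact Finset.sum_congr rfl fun b _ => by ring
  have hgeo : IsGeodetic g l := by
    intro e he y hy
    refine ⟨-(derivAlong l (fun p => Real.sqrt |Φ p|) (e.symm y) / Real.sqrt |Φ (e.symm y)|),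
      fun a => ?_⟩
    have h := key e he y hy a
    have h0 := (hcpos (e.symm y)).ne'
    field_simp
    linarith
  have hopt : OpticalMatrixSatisfies g l fun L => L = 0 := by
    intro e he y hy k m hF
    funext i j
    have h := (rescaled_kundt hn hl hΦ hΦ0 hβ hsol hric hweyl he hy).2 (m j) (m i)
      (hF.l_m j) (hF.l_m i)
    have h1 : ∑ a, lower (g.inChart e) (vecInChart l e) y a * m i a = 0 :=
      ((isMetricOn_inChart g he).sum_lower_mul _ _).trans (hF.l_m i)
    have h2 : Real.sqrt |Φ (e.symm y)| * opticalMatrix (g.inChart e) (vecInChart l e) y m i j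
        = 0 := by
      have h3 : comp2 (nabla1 (g.inChart e) (fun z a => Real.sqrt |Φ (e.symm z)|
            * lower (g.inChart e) (vecInChart l e) z a) y) (m j) (m i)
          = (∑ b, pd (fun z => Real.sqrt |Φ (e.symm z)|) b y * m j b)
              * (∑ a, lower (g.inChart e) (vecInChart l e) y a * m i a)
            + Real.sqrt |Φ (e.symm y)|
              * opticalMatrix (g.inChart e) (vecInChart l e) y m i j := by
        rw [opticalMatrix, Finset.sum_comm, Finset.sum_mul_sum]
        simp only [comp2, hmul e he y hy, Finset.mul_sum, ← Finset.sum_add_distrib]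
        exact Finset.sum_congr rfl fun _ _ => Finset.sum_congr rfl fun _ _ => by ring
      rw [h3, h1, mul_zero, zero_add] at h
      exact h
    exact (mul_eq_zero.1 h2).resolve_left (hcpos _).ne'
  have hexp : NonExpanding g l := fun e he y hy k m hF => by
    simp only [hopt e he y hy k m hF, expansion, Pi.zero_apply, Finset.sum_const_zero, mul_zero]
  have hshear : NonShearing g l := fun e he y hy k m hF => by
    simp [hopt e he y hy k m hF, shearSq, expansion]
  have htwist : NonTwisting g l := fun e he y hy k m hF => by
    simp [hopt e he y hy k m hF, twistSq]
  refine ⟨⟨l, hl, hgeo, hexp, hshear, htwist⟩, hgeo, hexp, hshear, htwist, fun haff p => ?_,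
    fun p => Real.sqrt |Φ p|, hc, hcpos, fun e he y hy a => ?_, fun p => ?_⟩
  · have he := IsManifold.chart_mem_maximalAtlas (I := 𝓡 n) (n := ∞) p
    set e := chartAt (EuclideanSpace ℝ (Fin n)) p
    have hy : e p ∈ e.target := e.map_source (mem_chart_source _ p)
    have hpe : e.symm (e p) = p := e.left_inv (mem_chart_source _ p)
    obtain ⟨a, ha⟩ := hl.exists_lower_ne_zero (by omega) he hy
    have h := key e he (e p) hy a
    rw [haff e he (e p) hy a, mul_zero, eq_comm, neg_eq_zero] at h
    have hDc := (mul_eq_zero.1 h).resolve_right ha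
    rw [hpe] at hDc
    obtain ⟨ε, hε, hopen, hp, hsign⟩ := exists_sign hΦ.continuous hΦ0 p
    have hloc : Φ =ᶠ[nhds p] fun q => ε * Real.sqrt |Φ q| ^ 2 :=
      Filter.eventuallyEq_of_mem (hopen.mem_nhds hp) hsign
    rw [derivAlong, hloc.mfderiv_eq]
    change derivAlong l (fun q => ε * Real.sqrt |Φ q| ^ 2) p = 0
    simp only [pow_two]
    have hcd : MDifferentiableAt (𝓡 n) 𝓘(ℝ, ℝ) (fun q => Real.sqrt |Φ q|) (e.symm (e p)) :=
      (hc _).mdifferentiableAt (by simp)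
    have hcd' := differentiableAt_of_contDiffOn e.open_target (contDiffOn_comp_symm hc he) hy
    have hff : ContMDiff (𝓡 n) 𝓘(ℝ, ℝ) ∞ fun q => ε * (Real.sqrt |Φ q| * Real.sqrt |Φ q|) :=
      contMDiff_const.mul (hc.mul hc)
    rw [← hpe, derivAlong_eq_sum he hy l hcd] at hDc
    rw [← hpe, derivAlong_eq_sum he hy l ((hff _).mdifferentiableAt (by simp))]
    have hpd : ∀ a, pd (fun z => ε * (Real.sqrt |Φ (e.symm z)| * Real.sqrt |Φ (e.symm z)|)) a (e p)
        = 2 * ε * Real.sqrt |Φ (e.symm (e p))|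
          * pd (fun z => Real.sqrt |Φ (e.symm z)|) a (e p) := fun a => by
      rw [pd_const_mul (f := fun z => Real.sqrt |Φ (e.symm z)| * Real.sqrt |Φ (e.symm z)|)
        (hcd'.mul hcd'), pd_mul hcd' hcd']
      ring
    simp only [hpd, mul_assoc (2 * ε * Real.sqrt |Φ (e.symm (e p))|)]
    rw [← Finset.mul_sum, hDc, mul_zero]
  · rw [lower_smul]
    have h := (rescaled_kundt hn hl hΦ hΦ0 hβ hsol hric hweyl he hy).1 a
    have h1 : ∀ b, vecInChart (fun p => Real.sqrt |Φ p| • l p) e y b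
        = Real.sqrt |Φ (e.symm y)| * vecInChart l e y b := fun b => vecInChart_smul _ _ _ _ _
    simp only [h1, mul_left_comm _ (Real.sqrt |Φ (e.symm y)|), ← Finset.mul_sum]
    rw [h, mul_zero]
  · obtain ⟨ε, hε, hopen, hp, hsign⟩ := exists_sign hΦ.continuous hΦ0 p
    have hloc : (fun q => Φ q / Real.sqrt |Φ q| ^ 2) =ᶠ[nhds p] fun _ => ε := by
      refine Filter.eventuallyEq_of_mem (hopen.mem_nhds hp) fun q hq => ?_
      rw [div_eq_iff (pow_ne_zero 2 (hcpos q).ne')]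
      exact hsign q hq
    rw [derivAlong, hloc.mfderiv_eq, mfderiv_const]
    rfl
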